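/- Let $G$ be a finite group, $A\trianglelefteq G$ a normal subgroup, $Q=G/A$ with projection $\pi:G\to Q$, and let $\rho:A\to U(V_\rho)$ be an irreducible finite-dimensional complex unitary representation whose isomorphism class is $G$-invariant: $g\cdot\rho\cong\rho$ for every $g\in G$, where $(g\cdot\rho)(a)=\rho(g^{-1}ag)$. *The cocycle.* There exist choices $(\sigma,M)$ consisting of a map $\sigma:Q\to G$ with $\pi\sigma=\mathrm{id}$, $\sigma(1)=1$, and elements $M_q\in U(V_\rho)$ $(q\in Q)$ with $M_1=1$ and $\rho(\sigma(q)^{-1}a\,\sigma(q))=M_q^{-1}\rho(a)M_q$ for all $a\in A$. Fix any such choice and put $\chi(q_1,q_2)=\sigma(q_1q_2)^{-1}\sigma(q_1)\sigma(q_2)\in A$. Then $$\alpha_\rho(q_1,q_2)=\rho(\chi(q_1,q_2))\,M_{q_2}^{-1}M_{q_1}^{-1}M_{q_1q_2}$$ is a scalar in $\mathbb S^1$, and $\alpha_\rho$ is a normalized 2-cocycle on $Q$ with values in $\mathbb S^1$. Let $\widetilde Q_{\alpha_\rho}=Q\times\mathbb S^1$ with product $(q_1,z_1)(q_2,z_2)=(q_1q_2,\alpha_\rho(q_1,q_2)z_1z_2)$,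 a central extension of $Q$ by $\mathbb S^1$. *The K-groups.* Let $X$ be a compact Hausdorff $G$-space on which $A$ acts trivially; it is then a $Q$-space and a $\widetilde Q_{\alpha_\rho}$-space. A $(G,\rho)$-equivariant vector bundle over $X$ is a $G$-equivariant complex vector bundle $E\to X$ for which the evaluation map $\mathbb V_\rho\otimes\mathrm{Hom}_A(\mathbb V_\rho,E)\to E$, $v\otimes f\mapsto f(v)$, is an isomorphism, where $\mathbb V_\rho=X\times V_\rho$. Let $K^0_{G,\rho}(X)$ be the Grothendieck group of isomorphism classes of $(G,\rho)$-equivariant vector bundles over $X$, and ${}^{\alpha_\rho}K^0_Q(X)$ that of $\widetilde Q_{\alpha_\rho}$-equivariant vector bundles over $X$ on which the central $\mathbb S^1$ acts by multiplication by scalars. For $n>0$ let $K^n_{G,\rho}(X)=\widetilde K^0_{G,\rho}(\Sigma^nX_+)$ and ${}^{\alpha_\rho}K^n_Q(X)={}^{\alpha_\rho}\widetilde K^0_Q(\Sigma^nX_+)$, where $\widetilde K^0$ of a pointed space is the kernel of restriction to the base point. All these groups are modules over the representation ring $R(Q)$ through the tensor product of bundles with representations of $Q$. *The statement.* For every $(G,\rho)$-equivariant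 vector bundle $E$ over $X$, the bundle $\mathrm{Hom}_A(\mathbb V_\rho,E)$ with the action $$((q,z)\cdot f)(v)=z\,\sigma(q)\cdot f(M_q^{-1}v)$$ is a $\widetilde Q_{\alpha_\rho}$-equivariant vector bundle on which the central $\mathbb S^1$ acts by multiplication by scalars, and the assignment $[E]\mapsto[\mathrm{Hom}_A(\mathbb V_\rho,E)]$ (applied to bundles over $X$ for $n=0$ and over $\Sigma^nX_+$ for $n>0$) induces isomorphisms of $R(Q)$-modules $$K^n_{G,\rho}(X)\;\xrightarrow{\ \cong\ }\;{}^{\alpha_\rho}K^n_Q(X)\qquad(n\ge 0),$$ natural with respect to continuous $G$-maps $X\to Y$ between compact Hausdorff $G$-spaces on which $A$ acts trivially. -/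

import Mathlib

set_option linter.unusedSectionVars false
set_option linter.checkUnivs false

universe u v w w'

noncomputable section

namespace EqK

open Topology TensorProduct

section Grothendieck

/-! Grothendieck groups of semirings and semimodules -/

open Algebra

variable {S : Type w} {M : Type u} [AddCommMonoid M]

/-- The class of an element in the Grothendieck group. -/
def gOf : M →+ GrothendieckAddGroup M := GrothendieckAddGroup.of

theorem groth_induction {P : GrothendieckAddGroup M → Prop}
    (of : ∀ m, P (gOf m)) (add : ∀ a b, P a → P b → P (a + b))
    (neg : ∀ a, P a → P (-a)) (x : GrothendieckAddGroup M) : P x := by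
  induction x using AddLocalization.ind with
  | H y =>
    obtain ⟨m, s⟩ := y
    have h : (AddLocalization.mk m s : GrothendieckAddGroup M)
        = gOf m + -gOf (s : M) := by
      rw [← sub_eq_add_neg, eq_sub_iff_add_eq, AddLocalization.mk_eq_addMonoidOf_mk']
      exact AddSubmonoid.LocalizationMap.mk'_spec _ _ _
    rw [h]
    exact add _ _ (of _) (neg _ (of _))

/-- The additive map of Grothendieck groups induced by an additive map. -/
def grothMap {N : Type v} [AddCommMonoid N] (f : M →+ N) :
    GrothendieckAddGroup M →+ GrothendieckAddGroup N :=
  GrothendieckAddGroup.lift (gOf.comp f)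

@[simp] theorem groth_lift_of {H : Type v} [AddCommGroup H] (f : M →+ H) (m : M) :
    GrothendieckAddGroup.lift f (gOf m) = f m :=
  DFunLike.congr_fun (GrothendieckAddGroup.lift.symm_apply_apply f) m

@[simp] theorem grothMap_of {N : Type v} [AddCommMonoid N] (f : M →+ N) (m : M) :
    grothMap f (gOf m) = gOf (f m) :=
  groth_lift_of _ _

/-- The biadditive extension of `s • m` to Grothendieck groups. -/
def grothSMul [Semiring S] [Module S M] :
    GrothendieckAddGroup S →+ GrothendieckAddGroup M →+ GrothendieckAddGroup M :=
  GrothendieckAddGroup.lift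
    { toFun := fun s => grothMap (DistribSMul.toAddMonoidHom M s)
      map_zero' := by
        ext x
        induction x using groth_induction with
        | of m => simp
        | add a b ha hb => rw [map_add, ha, hb, map_add]
        | neg a ha => rw [map_neg, ha, map_neg]
      map_add' := fun s t => by
        ext x
        induction x using groth_induction with
        | of m => simp [add_smul]
        | add a b ha hb => rw [map_add, ha, hb, map_add]
        | neg a ha => rw [map_neg, ha, map_neg] }

@[simp] theorem grothSMul_of [Semiring S] [Module S M] (s : S) (m : M) :
    grothSMul (gOf s) (gOf m)
      = gOf (s • m) := by
  simp [grothSMul]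

theorem grothSMul_assoc [Semiring S] [Module S M] (a b : GrothendieckAddGroup S)
    (x : GrothendieckAddGroup M) :
    grothSMul (grothSMul a b) x = grothSMul a (grothSMul b x) := by
  induction a using groth_induction with
  | add a a' h h' => simp only [map_add, AddMonoidHom.add_apply, h, h']
  | neg a h => simp only [map_neg, AddMonoidHom.neg_apply, h]
  | of s =>
    induction b using groth_induction with
    | add a a' h h' => simp only [map_add, AddMonoidHom.add_apply, h, h']
    | neg a h => simp only [map_neg, AddMonoidHom.neg_apply, h]
    | of t =>
      induction x using groth_induction with
      | add a a' h h' => simp only [map_add, h, h']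
      | neg a h => simp only [map_neg, h]
      | of m => simp [mul_smul]

theorem grothMap_smul [Semiring S] [Module S M] {N : Type v} [AddCommMonoid N] [Module S N]
    (f : M →ₗ[S] N) (r : GrothendieckAddGroup S) (x : GrothendieckAddGroup M) :
    grothMap f.toAddMonoidHom (grothSMul r x) = grothSMul r (grothMap f.toAddMonoidHom x) := by
  induction r using groth_induction with
  | add a a' h h' => simp only [map_add, AddMonoidHom.add_apply, h, h']
  | neg a h => simp only [map_neg, AddMonoidHom.neg_apply, h]
  | of s =>
    induction x using groth_induction with
    | add a a' h h' => simp only [map_add, h, h']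
    | neg a h => simp only [map_neg, h]
    | of m => simp

theorem grothSMul_one [Semiring S] [Module S M] (x : GrothendieckAddGroup M) :
    grothSMul (gOf (1 : S)) x = x := by
  induction x using groth_induction with
  | add a a' h h' => simp only [map_add, h, h']
  | neg a h => simp only [map_neg, h]
  | of m => simp

theorem grothSMul_comm [CommSemiring S] (a b : GrothendieckAddGroup S) :
    grothSMul a b = grothSMul b a := by
  induction a using groth_induction with
  | add a a' h h' => simp only [map_add, AddMonoidHom.add_apply, h, h']
  | neg a h => simp only [map_neg, AddMonoidHom.neg_apply, h]
  | of s =>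
    induction b using groth_induction with
    | add a a' h h' => simp only [map_add, AddMonoidHom.add_apply, h, h']
    | neg a h => simp only [map_neg, AddMonoidHom.neg_apply, h]
    | of t => simp [mul_comm]

end Grothendieck

section RepresentationRing

/-- A finite-dimensional complex representation of `Q`. -/
structure FinRep (Q : Type w) [Group Q] where
  carrier : Type v
  [addCommGroup : AddCommGroup carrier]
  [module : Module ℂ carrier]
  [finite : FiniteDimensional ℂ carrier]
  rep : Representation ℂ Q carrier

attribute [instance] FinRep.addCommGroup FinRep.module FinRep.finite

variable (Q : Type w) [Group Q]

instance FinRep.setoid : Setoid (FinRep.{v} Q) where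
  r W W' := ∃ e : W.carrier ≃ₗ[ℂ] W'.carrier, ∀ q w, e (W.rep q w) = W'.rep q (e w)
  iseqv :=
    { refl := fun W => ⟨LinearEquiv.refl _ _, fun _ _ => rfl⟩
      symm := fun {W W'} ⟨e, h⟩ => ⟨e.symm, fun q w => by
        apply e.injective; rw [h]; simp⟩
      trans := fun ⟨e, h⟩ ⟨e', h'⟩ => ⟨e.trans e', fun q w => by simp [h, h']⟩ }

/-- Isomorphism classes of finite-dimensional complex representations of `Q`. -/
def RepClass : Type (max w (v + 1)) := Quotient (FinRep.setoid.{v, w} Q)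

variable {Q}

/-- Direct sum of representations. -/
abbrev FinRep.sum (W W' : FinRep.{v} Q) : FinRep.{v} Q where
  carrier := W.carrier × W'.carrier
  rep := W.rep.prod W'.rep

/-- Tensor product of representations. -/
abbrev FinRep.tensor (W W' : FinRep.{v} Q) : FinRep.{v} Q where
  carrier := W.carrier ⊗[ℂ] W'.carrier
  rep := W.rep.tprod W'.rep

variable (Q) in
/-- The zero representation. -/
abbrev FinRep.zero : FinRep.{v} Q where
  carrier := PUnit.{v + 1}
  rep := 1

variable (Q) in
/-- The trivial one-dimensional representation. -/
abbrev FinRep.triv : FinRep.{v} Q where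
  carrier := ULift.{v} ℂ
  rep := 1

theorem tmul_equiv_of_tmul {W W' F : Type*} [AddCommGroup W] [AddCommGroup W'] [AddCommGroup F]
    [Module ℂ W] [Module ℂ W'] [Module ℂ F] {f g : W ⊗[ℂ] W' →ₗ[ℂ] F}
    (h : ∀ a b, f (a ⊗ₜ b) = g (a ⊗ₜ b)) (t : W ⊗[ℂ] W') : f t = g t :=
  DFunLike.congr_fun (TensorProduct.ext' h) t

instance : Zero (RepClass.{v} Q) := ⟨Quotient.mk _ (FinRep.zero Q)⟩
instance : One (RepClass.{v} Q) := ⟨Quotient.mk _ (FinRep.triv Q)⟩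

instance : Add (RepClass.{v} Q) :=
  ⟨Quotient.map₂ FinRep.sum fun _ _ ⟨e, h⟩ _ _ ⟨e', h'⟩ =>
    ⟨e.prodCongr e', fun q w => Prod.ext (h q w.1) (h' q w.2)⟩⟩

instance : Mul (RepClass.{v} Q) :=
  ⟨Quotient.map₂ FinRep.tensor fun W₁ W₂ ⟨e, h⟩ W₃ W₄ ⟨e', h'⟩ =>
    ⟨TensorProduct.congr e e', fun q w => tmul_equiv_of_tmul
      (f := (TensorProduct.congr e e').toLinearMap ∘ₗ (W₁.tensor W₃).rep q)
      (g := (W₂.tensor W₄).rep q ∘ₗ (TensorProduct.congr e e').toLinearMap)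
      (fun a b => by simp [FinRep.tensor, h, h']) w⟩⟩

theorem RepClass.zero_mul' (a : RepClass.{v} Q) : 0 * a = 0 := by
  induction a using Quotient.ind with
  | _ W =>
    refine Quotient.sound ⟨⟨0, 0, fun t => ?_, fun t => ?_⟩, fun q t => rfl⟩
    · exact tmul_equiv_of_tmul (W := PUnit) (f := 0) (g := LinearMap.id)
        (fun a b => by rw [Subsingleton.elim a 0]; simp) t
    · rfl

theorem RepClass.mul_comm' (a b : RepClass.{v} Q) : a * b = b * a := by
  induction a, b using Quotient.inductionOn₂ with
  | _ W W' =>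
    exact Quotient.sound ⟨TensorProduct.comm ℂ _ _, fun q t => tmul_equiv_of_tmul
      (f := (TensorProduct.comm ℂ _ _).toLinearMap ∘ₗ (W.tensor W').rep q)
      (g := (W'.tensor W).rep q ∘ₗ (TensorProduct.comm ℂ _ _).toLinearMap)
      (fun a b => by simp [FinRep.tensor]) t⟩

theorem RepClass.mul_add' (a b c : RepClass.{v} Q) : a * (b + c) = a * b + a * c := by
  induction a, b, c using Quotient.inductionOn₃ with
  | _ W W' W'' =>
    exact Quotient.sound ⟨TensorProduct.prodRight ℂ ℂ _ _ _, fun q t => tmul_equiv_of_tmul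
      (f := (TensorProduct.prodRight ℂ ℂ W.carrier W'.carrier W''.carrier).toLinearMap
        ∘ₗ (W.tensor (W'.sum W'')).rep q)
      (g := ((W.tensor W').sum (W.tensor W'')).rep q ∘ₗ
        (TensorProduct.prodRight ℂ ℂ W.carrier W'.carrier W''.carrier).toLinearMap)
      (fun a b => by simp [FinRep.tensor, FinRep.sum]) t⟩

theorem RepClass.one_mul' (a : RepClass.{v} Q) : 1 * a = a := by
  induction a using Quotient.ind with
  | _ W =>
    let e : (ULift.{v} ℂ) ⊗[ℂ] W.carrier ≃ₗ[ℂ] W.carrier :=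
      (TensorProduct.congr ULift.moduleEquiv (LinearEquiv.refl _ _)).trans
        (TensorProduct.lid ℂ _)
    exact Quotient.sound ⟨e, fun q t => tmul_equiv_of_tmul
      (f := e.toLinearMap ∘ₗ ((FinRep.triv Q).tensor W).rep q)
      (g := W.rep q ∘ₗ e.toLinearMap)
      (fun a b => by simp [FinRep.tensor, FinRep.triv, e]) t⟩

theorem RepClass.mul_assoc' (a b c : RepClass.{v} Q) : a * b * c = a * (b * c) := by
  induction a, b, c using Quotient.inductionOn₃ with
  | _ W W' W'' =>
    refine Quotient.sound ⟨TensorProduct.assoc ℂ _ _ _, fun q t => ?_⟩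
    refine DFunLike.congr_fun (f := (TensorProduct.assoc ℂ _ _ _).toLinearMap ∘ₗ
      ((W.tensor W').tensor W'').rep q) (g := (W.tensor (W'.tensor W'')).rep q ∘ₗ
      (TensorProduct.assoc ℂ _ _ _).toLinearMap) ?_ t
    refine TensorProduct.ext_threefold fun a b c => ?_
    simp [FinRep.tensor]

instance : CommSemiring (RepClass.{v} Q) where
  add_assoc a b c := by
    induction a, b, c using Quotient.inductionOn₃ with
    | _ W W' W'' => exact Quotient.sound ⟨LinearEquiv.prodAssoc ℂ _ _ _, fun _ _ => rfl⟩
  zero_add a := by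
    induction a using Quotient.ind with
    | _ W => exact Quotient.sound ⟨LinearEquiv.uniqueProd, fun _ _ => rfl⟩
  add_zero a := by
    induction a using Quotient.ind with
    | _ W => exact Quotient.sound ⟨LinearEquiv.prodUnique, fun _ _ => rfl⟩
  add_comm a b := by
    induction a, b using Quotient.inductionOn₂ with
    | _ W W' => exact Quotient.sound ⟨LinearEquiv.prodComm ℂ _ _, fun _ _ => rfl⟩
  nsmul := nsmulRec
  left_distrib := RepClass.mul_add'
  right_distrib a b c := by
    rw [RepClass.mul_comm', RepClass.mul_add', RepClass.mul_comm' c, RepClass.mul_comm' c]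
  zero_mul := RepClass.zero_mul'
  mul_zero a := by rw [RepClass.mul_comm', RepClass.zero_mul']
  mul_assoc := RepClass.mul_assoc'
  one_mul := RepClass.one_mul'
  mul_one a := by rw [RepClass.mul_comm', RepClass.one_mul']
  mul_comm := RepClass.mul_comm'

variable (Q) in
/-- The complex representation ring `R(Q)`: the Grothendieck ring of the semiring of isomorphism
classes of finite-dimensional complex representations, with direct sum and tensor product. -/
def RepRing : Type (max w (v + 1)) := Algebra.GrothendieckAddGroup (RepClass.{v} Q)

instance : AddCommGroup (RepRing.{v} Q) :=
  inferInstanceAs (AddCommGroup (Algebra.GrothendieckAddGroup (RepClass.{v} Q)))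

instance : CommRing (RepRing.{v} Q) :=
  { (inferInstance : AddCommGroup (RepRing.{v} Q)) with
    mul := fun a b => grothSMul a b
    one := gOf (1 : RepClass.{v} Q)
    mul_assoc := grothSMul_assoc
    one_mul := grothSMul_one
    mul_one := fun a => (grothSMul_comm _ _).trans (grothSMul_one a)
    left_distrib := fun a b c => map_add (grothSMul a) b c
    right_distrib := fun a b c => DFunLike.congr_fun
      ((grothSMul (S := RepClass.{v} Q) (M := RepClass.{v} Q)).map_add a b) c
    zero_mul := fun a => DFunLike.congr_fun
      ((grothSMul (S := RepClass.{v} Q) (M := RepClass.{v} Q)).map_zero) a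
    mul_zero := fun a => map_zero (grothSMul a)
    mul_comm := grothSMul_comm }

/-- The Grothendieck group of an `S`-semimodule is a module over the Grothendieck ring; here for
the semiring of classes of representations. -/
abbrev grothModule (M : Type u) [AddCommMonoid M] [Module (RepClass.{v} Q) M] :
    Module (RepRing.{v} Q) (Algebra.GrothendieckAddGroup M) where
  smul a x := grothSMul (S := RepClass.{v} Q) a x
  one_smul := grothSMul_one
  mul_smul := grothSMul_assoc
  smul_zero a := map_zero (grothSMul a)
  smul_add a := map_add (grothSMul a)
  add_smul a b x := DFunLike.congr_fun
    ((grothSMul (S := RepClass.{v} Q) (M := M)).map_add a b) x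
  zero_smul x := DFunLike.congr_fun ((grothSMul (S := RepClass.{v} Q) (M := M)).map_zero) x

end RepresentationRing

section Families

variable {Γ : Type w'} [Group Γ] {Q : Type w} [Group Q]

/-- Let `p : Γ → Q` be a homomorphism of groups and `X` a `Q`-space, regarded as a `Γ`-space
through `p`.  A `Γ`-equivariant family of complex vector spaces over `X`: a topology on the
disjoint union of complex vector spaces `fiber x`, and a fibrewise linear action of `Γ` covering
the action on `X`.  The element `γ` maps the fibre at `x` to the fibre at `y = γ x`; to avoid
transports, `y` is a variable and `γ x = y` a hypothesis. -/
structure Family (p : Γ →* Q) (X : Type u) [MulAction Q X] where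
  fiber : X → Type v
  [addCommGroup : ∀ x, AddCommGroup (fiber x)]
  [module : ∀ x, Module ℂ (fiber x)]
  top : TopologicalSpace (Σ x, fiber x)
  act : ∀ (γ : Γ) {x y : X}, p γ • x = y → (fiber x →ₗ[ℂ] fiber y)
  act_one : ∀ {x : X} (h : p 1 • x = x) (e : fiber x), act 1 h e = e
  act_mul : ∀ (γ δ : Γ) {x y z : X} (h₁ : p δ • x = y) (h₂ : p γ • y = z)
    (h₃ : p (γ * δ) • x = z) (e : fiber x), act (γ * δ) h₃ e = act γ h₂ (act δ h₁ e)

attribute [instance] Family.addCommGroup Family.module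

variable {p : Γ →* Q} {X : Type u} [MulAction Q X]

namespace Family

/-- The total space of a family. -/
def Tot (E : Family.{u, v} p X) : Type (max u v) := Σ x, E.fiber x

instance (E : Family.{u, v} p X) : TopologicalSpace E.Tot := E.top

/-- The point of the total space given by a vector in a fibre. -/
def pt (E : Family.{u, v} p X) (x : X) (e : E.fiber x) : E.Tot := ⟨x, e⟩

/-- The projection to the base. -/
def proj (E : Family.{u, v} p X) (t : E.Tot) : X := t.1

/-- The vector part of a point of the total space. -/
def vec (E : Family.{u, v} p X) (t : E.Tot) : E.fiber (E.proj t) := t.2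

/-- The action of `Γ` on the total space. -/
def totAct (E : Family.{u, v} p X) (t : Γ × E.Tot) : E.Tot :=
  ⟨p t.1 • t.2.1, E.act t.1 rfl t.2.2⟩

/-- The family is a (finite-dimensional, locally trivial) `Γ`-equivariant complex vector bundle.
The rank may vary from one component of the base to another. -/
structure IsVectorBundle [TopologicalSpace Γ] [TopologicalSpace X] (E : Family.{u, v} p X) :
    Prop where
  continuous_proj : Continuous E.proj
  locally_trivial : ∀ x : X, ∃ U : Set X, IsOpen U ∧ x ∈ U ∧
    ∃ (ι : Type) (_ : Fintype ι) (φ : ∀ y : U, E.fiber y ≃ₗ[ℂ] (ι → ℂ)),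
      Continuous (fun t : {t : E.Tot // E.proj t ∈ U} => φ ⟨E.proj t, t.2⟩ (E.vec t)) ∧
      Continuous (fun s : U × (ι → ℂ) => E.pt s.1 ((φ s.1).symm s.2))
  continuous_act : Continuous E.totAct

/-- The fibrewise linear map of total spaces. -/
def totMap {E F : Family.{u, v} p X} (f : ∀ x, E.fiber x →ₗ[ℂ] F.fiber x) (t : E.Tot) : F.Tot :=
  ⟨t.1, f t.1 t.2⟩

/-- Isomorphism of `Γ`-equivariant families: a `Γ`-equivariant homeomorphism over `X` which is
linear on the fibres. -/
def Iso (E F : Family.{u, v} p X) : Prop :=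
  ∃ e : ∀ x, E.fiber x ≃ₗ[ℂ] F.fiber x,
    (∀ (γ : Γ) (x y : X) (h : p γ • x = y) (a : E.fiber x),
      e y (E.act γ h a) = F.act γ h (e x a)) ∧
    Continuous (totMap fun x => (e x).toLinearMap) ∧
    Continuous (totMap fun x => (e x).symm.toLinearMap)

theorem Iso.refl (E : Family.{u, v} p X) : E.Iso E :=
  ⟨fun _ => LinearEquiv.refl _ _, fun _ _ _ _ _ => rfl, continuous_id, continuous_id⟩

theorem Iso.symm {E F : Family.{u, v} p X} : E.Iso F → F.Iso E := fun ⟨e, h, h₁, h₂⟩ =>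
  ⟨fun x => (e x).symm, fun γ x y hxy a => by apply (e y).injective; rw [h]; simp, h₂, h₁⟩

theorem Iso.trans {E F H : Family.{u, v} p X} : E.Iso F → F.Iso H → E.Iso H :=
  fun ⟨e, h, h₁, h₂⟩ ⟨e', h', h₁', h₂'⟩ =>
  ⟨fun x => (e x).trans (e' x), fun γ x y hxy a => by simp [h, h'],
    h₁'.comp h₁, h₂.comp h₂'⟩

section Topological

variable [TopologicalSpace Γ] [TopologicalSpace X]

/-- A continuous, fibrewise bijective morphism of vector bundles is an isomorphism. -/
theorem iso_of_continuous {E F : Family.{u, v} p X} (hE : E.IsVectorBundle)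
    (hF : F.IsVectorBundle) (e : ∀ x, E.fiber x ≃ₗ[ℂ] F.fiber x)
    (he : ∀ (γ : Γ) (x y : X) (h : p γ • x = y) (a : E.fiber x),
      e y (E.act γ h a) = F.act γ h (e x a))
    (hc : Continuous (totMap (E := E) (F := F) fun x => (e x).toLinearMap)) : E.Iso F := by
  refine ⟨e, he, hc, continuous_iff_continuousAt.2 fun t₀ => ?_⟩
  obtain ⟨U, hU, hxU, ι, _, φ, hφ, hφ'⟩ := hE.locally_trivial t₀.1
  obtain ⟨U', hU', hxU', κ, _, ψ, hψ, hψ'⟩ := hF.locally_trivial t₀.1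
  have hN : IsOpen (U ∩ U') := hU.inter hU'
  let T := {t : F.Tot // F.proj t ∈ U ∩ U'}
  have hT : IsOpen {t : F.Tot | F.proj t ∈ U ∩ U'} := hN.preimage hF.continuous_proj
  let i : ↥(U ∩ U') → U := fun y => ⟨y, y.2.1⟩
  let j : ↥(U ∩ U') → U' := fun y => ⟨y, y.2.2⟩
  have hi : Continuous i := by fun_prop
  have hj : Continuous j := by fun_prop
  let B : ↥(U ∩ U') → ((ι → ℂ) ≃L[ℂ] (κ → ℂ)) := fun y =>
    (((φ (i y)).symm.trans (e y)).trans (ψ (j y))).toContinuousLinearEquiv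
  have hB : Continuous fun y => (B y : (ι → ℂ) →L[ℂ] (κ → ℂ)) := by
    rw [continuous_clm_apply]
    intro c
    have h₁ : Continuous fun y : ↥(U ∩ U') => E.pt y ((φ (i y)).symm c) :=
      hφ'.comp (hi.prodMk continuous_const)
    have h₂ := hc.comp h₁
    exact hψ.comp (h₂.subtype_mk fun y => y.2.2)
  have hB' : Continuous fun y => ((B y).symm : (κ → ℂ) →L[ℂ] (ι → ℂ)) := by
    have : (fun y => ((B y).symm : (κ → ℂ) →L[ℂ] (ι → ℂ)))
        = fun y => ContinuousLinearMap.inverse (B y : (ι → ℂ) →L[ℂ] (κ → ℂ)) := by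
      ext1 y; simp
    rw [this]
    refine continuous_iff_continuousAt.2 fun y => ?_
    have := (contDiffAt_map_inverse (𝕜 := ℂ) (n := 0) (B y)).continuousAt
    exact ContinuousAt.comp (f := fun y => (B y : (ι → ℂ) →L[ℂ] (κ → ℂ))) this hB.continuousAt
  let pr : T → ↥(U ∩ U') := fun t => ⟨t.1.1, t.2⟩
  have hpr : Continuous pr :=
    (hF.continuous_proj.comp continuous_subtype_val).subtype_mk _
  have hψT : Continuous fun t : T => ψ (j (pr t)) t.1.2 :=
    hψ.comp (continuous_subtype_val.subtype_mk fun t : T => t.2.2)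
  have key : Continuous fun t : T =>
      E.pt t.1.1 ((φ (i (pr t))).symm ((B (pr t)).symm (ψ (j (pr t)) t.1.2))) :=
    hφ'.comp ((hi.comp hpr).prodMk ((hB'.comp hpr).clm_apply hψT))
  have key' : (fun t : T => totMap (E := F) (F := E) (fun x => (e x).symm.toLinearMap) t.1)
      = fun t : T =>
      E.pt t.1.1 ((φ (i (pr t))).symm ((B (pr t)).symm (ψ (j (pr t)) t.1.2))) := by
    ext1 t
    have : (φ (i (pr t))).symm ((B (pr t)).symm (ψ (j (pr t)) t.1.2)) = (e t.1.1).symm t.1.2 := by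
      apply (φ (i (pr t))).injective
      rw [LinearEquiv.apply_symm_apply]
      apply (B (pr t)).injective
      rw [ContinuousLinearEquiv.apply_symm_apply]
      simp [B, i, pr]
    rw [this]; rfl
  rw [← key'] at key
  exact (hT.isOpenEmbedding_subtypeVal.continuousAt_iff (x := ⟨t₀, hxU, hxU'⟩)).1
    key.continuousAt

end Topological

/-- The action of the kernel of `p` on the fibre at `x`. -/
def kerRep (E : Family.{u, v} p X) (x : X) : Representation ℂ p.ker (E.fiber x) where
  toFun k := E.act (k : Γ) (by rw [k.2, one_smul])
  map_one' := by ext a; exact E.act_one _ a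
  map_mul' k l := by ext a; exact E.act_mul _ _ _ _ _ a

/-- The zero family. -/
def zero (p : Γ →* Q) (X : Type u) [MulAction Q X] [TopologicalSpace X] : Family.{u, v} p X where
  fiber _ := PUnit.{v + 1}
  top := TopologicalSpace.induced (fun t => t.1) inferInstance
  act _ _ _ _ := 0
  act_one _ _ := rfl
  act_mul _ _ _ _ _ _ _ _ _ := rfl

/-- The fibrewise direct sum. -/
def sum (E F : Family.{u, v} p X) : Family.{u, v} p X where
  fiber x := E.fiber x × F.fiber x
  top := TopologicalSpace.induced
    (fun t => (E.pt t.1 t.2.1, F.pt t.1 t.2.2)) inferInstance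
  act γ _ _ h := (E.act γ h).prodMap (F.act γ h)
  act_one h e := Prod.ext (E.act_one h e.1) (F.act_one h e.2)
  act_mul γ δ _ _ _ h₁ h₂ h₃ e :=
    Prod.ext (E.act_mul γ δ h₁ h₂ h₃ e.1) (F.act_mul γ δ h₁ h₂ h₃ e.2)

/-- Contraction of `W ⊗ F` with a linear form on `W`. -/
def contract {W F : Type v} [AddCommGroup W] [Module ℂ W] [AddCommGroup F] [Module ℂ F]
    (φ : Module.Dual ℂ W) : W ⊗[ℂ] F →ₗ[ℂ] F :=
  (TensorProduct.lid ℂ F).toLinearMap ∘ₗ LinearMap.rTensor F φ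

@[simp] theorem contract_tmul {W F : Type v} [AddCommGroup W] [Module ℂ W] [AddCommGroup F]
    [Module ℂ F] (φ : Module.Dual ℂ W) (a : W) (b : F) : contract φ (a ⊗ₜ[ℂ] b) = φ a • b := by
  simp [contract]

/-- The tensor product of a family with a representation `W` of `Q`.  Its total space carries the
coarsest topology for which the projection to `X` and the contractions with the linear forms on
`W` are continuous (for bundles, and `W` with a basis of `n` elements, this is the topology of the
`n`-fold direct sum). -/
def tensor (W : FinRep.{v} Q) (E : Family.{u, v} p X) [TopologicalSpace X] :
    Family.{u, v} p X where
  fiber x := W.carrier ⊗[ℂ] E.fiber x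
  top := TopologicalSpace.induced
    (fun t => (t.1, fun φ : Module.Dual ℂ W.carrier => E.pt t.1 (contract φ t.2))) inferInstance
  act γ _ _ h := TensorProduct.map (W.rep (p γ)) (E.act γ h)
  act_one {x} h e := by
    refine tmul_equiv_of_tmul (g := LinearMap.id) (fun a b => ?_) e
    rw [TensorProduct.map_tmul, E.act_one, map_one, map_one]; rfl
  act_mul γ δ x y z h₁ h₂ h₃ e := by
    refine tmul_equiv_of_tmul (g := TensorProduct.map (W.rep (p γ)) (E.act γ h₂) ∘ₗ
      TensorProduct.map (W.rep (p δ)) (E.act δ h₁)) (fun a b => ?_) e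
    rw [TensorProduct.map_tmul, E.act_mul γ δ h₁ h₂ h₃, map_mul, map_mul]; rfl

end Family

/-- A continuous `Q`-equivariant map. -/
structure EqMap (Q : Type w) [Group Q] (X Y : Type u) [MulAction Q X] [MulAction Q Y]
    [TopologicalSpace X] [TopologicalSpace Y] where
  toFun : X → Y
  continuous : Continuous toFun
  map_smul : ∀ (q : Q) (x : X), toFun (q • x) = q • toFun x

/-- The pullback of a family along an equivariant map. -/
def Family.pullback {Y : Type u} [MulAction Q Y] [TopologicalSpace X] [TopologicalSpace Y]
    (f : EqMap Q X Y) (E : Family.{u, v} p Y) : Family.{u, v} p X where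
  fiber x := E.fiber (f.toFun x)
  top := TopologicalSpace.induced
    (fun t => (t.1, E.pt (f.toFun t.1) t.2)) inferInstance
  act γ _ _ h := E.act γ (by rw [← f.map_smul, h])
  act_one _ e := E.act_one _ e
  act_mul γ δ _ _ _ h₁ h₂ h₃ e := E.act_mul γ δ _ _ _ e

namespace Family

theorem isInducing_zero [TopologicalSpace X] :
    IsInducing (zero.{u, v} p X).proj := ⟨rfl⟩

theorem isInducing_sum (E F : Family.{u, v} p X) :
    IsInducing fun t : (E.sum F).Tot => (E.pt t.1 t.2.1, F.pt t.1 t.2.2) := ⟨rfl⟩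

theorem isInducing_tensor [TopologicalSpace X] (W : FinRep.{v} Q) (E : Family.{u, v} p X) :
    IsInducing fun t : (E.tensor W).Tot =>
      (t.1, fun φ : Module.Dual ℂ W.carrier => E.pt t.1 (contract φ t.2)) := ⟨rfl⟩

theorem isInducing_pullback {Y : Type u} [MulAction Q Y] [TopologicalSpace X]
    [TopologicalSpace Y]
    (f : EqMap Q X Y) (E : Family.{u, v} p Y) :
    IsInducing fun t : (E.pullback f).Tot => (t.1, E.pt (f.toFun t.1) t.2) := ⟨rfl⟩

theorem continuous_sum_fst (E F : Family.{u, v} p X) :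
    Continuous fun t : (E.sum F).Tot => E.pt t.1 t.2.1 :=
  continuous_fst.comp (isInducing_sum E F).continuous

theorem continuous_sum_snd (E F : Family.{u, v} p X) :
    Continuous fun t : (E.sum F).Tot => F.pt t.1 t.2.2 :=
  continuous_snd.comp (isInducing_sum E F).continuous

theorem continuous_tensor_fst [TopologicalSpace X] (W : FinRep.{v} Q) (E : Family.{u, v} p X) :
    Continuous (E.tensor W).proj :=
  continuous_fst.comp (isInducing_tensor W E).continuous

theorem continuous_tensor_contract [TopologicalSpace X] (W : FinRep.{v} Q) (E : Family.{u, v} p X)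
    (φ : Module.Dual ℂ W.carrier) :
    Continuous fun t : (E.tensor W).Tot => E.pt t.1 (contract φ t.2) :=
  (continuous_apply φ).comp (continuous_snd.comp (isInducing_tensor W E).continuous)

theorem sum_contract {W F : Type v} {κ : Type*} [Fintype κ] [AddCommGroup W] [Module ℂ W]
    [AddCommGroup F] [Module ℂ F] (b : Module.Basis κ ℂ W) (t : W ⊗[ℂ] F) :
    ∑ k, b k ⊗ₜ[ℂ] contract (b.coord k) t = t := by
  have := tmul_equiv_of_tmul (g := LinearMap.id)
    (f := ∑ k, (TensorProduct.mk ℂ W F (b k)) ∘ₗ contract (b.coord k)) (fun w e => by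
      simp only [LinearMap.sum_apply, LinearMap.comp_apply, contract_tmul,
        TensorProduct.mk_apply, LinearMap.id_apply, ← TensorProduct.smul_tmul,
        ← TensorProduct.sum_tmul]
      congr 1
      exact b.sum_repr w) t
  simpa using this

theorem contract_sum {W F : Type v} {κ : Type*} [Fintype κ] [AddCommGroup W] [Module ℂ W]
    [AddCommGroup F] [Module ℂ F] (b : Module.Basis κ ℂ W) (c : κ → F) (k : κ) :
    contract (b.coord k) (∑ l, b l ⊗ₜ[ℂ] c l) = c k := by
  classical
  simp [Finsupp.single_apply]

/-- Coordinates on `W ⊗ F` from bases. -/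
def tensorEquiv {W F : Type v} {κ ι : Type*} [Fintype κ] [AddCommGroup W] [Module ℂ W]
    [AddCommGroup F] [Module ℂ F] (b : Module.Basis κ ℂ W) (φ : F ≃ₗ[ℂ] (ι → ℂ)) :
    W ⊗[ℂ] F ≃ₗ[ℂ] (κ × ι → ℂ) where
  toFun t s := φ (contract (b.coord s.1) t) s.2
  map_add' t t' := by ext; simp
  map_smul' c t := by ext; simp
  invFun c := ∑ k, b k ⊗ₜ[ℂ] φ.symm fun i => c (k, i)
  left_inv t := by
    simpa using sum_contract b t
  right_inv c := by
    ext s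
    simp only [contract_sum b, LinearEquiv.apply_symm_apply]

end Family

section Operations

variable [TopologicalSpace Γ] [TopologicalSpace X]

theorem continuous_of_locallyConstant {S T : Type*} [TopologicalSpace S] [TopologicalSpace T]
    (hp : IsLocallyConstant p) (F : Q → Γ × S → T) (hF : ∀ q, Continuous (F q)) :
    Continuous fun s : Γ × S => F (p s.1) s := by
  refine continuous_iff_continuousAt.2 fun s => ?_
  have h : ∀ᶠ s' in 𝓝 s, p s'.1 = p s.1 :=
    continuous_fst.continuousAt.eventually (hp.eventually_eq s.1)
  refine (hF (p s.1)).continuousAt.congr ?_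
  filter_upwards [h] with s' hs'
  rw [hs']

namespace Family

theorem continuous_baseAct [ContinuousConstSMul Q X] (hp : IsLocallyConstant p) :
    Continuous fun s : Γ × X => p s.1 • s.2 :=
  continuous_of_locallyConstant hp (fun q s => q • s.2) fun q => by fun_prop

theorem isVectorBundle_zero [ContinuousConstSMul Q X] (hp : IsLocallyConstant p) :
    (zero.{u, v} p X).IsVectorBundle where
  continuous_proj := isInducing_zero.continuous
  locally_trivial x := by
    refine ⟨Set.univ, isOpen_univ, trivial, Empty, inferInstance, fun y =>
      { toFun := fun _ => 0
        map_add' := fun _ _ => Subsingleton.elim _ _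
        map_smul' := fun _ _ => Subsingleton.elim _ _
        invFun := fun _ => PUnit.unit
        left_inv := fun _ => rfl
        right_inv := fun _ => Subsingleton.elim _ _ }, ?_, ?_⟩
    · exact continuous_pi fun i => i.elim
    · exact isInducing_zero.continuous_iff.2 (continuous_subtype_val.comp continuous_fst)
  continuous_act := isInducing_zero.continuous_iff.2
    ((continuous_baseAct hp).comp (continuous_fst.prodMk
      (isInducing_zero.continuous.comp continuous_snd)))

theorem IsVectorBundle.sum {E F : Family.{u, v} p X} (hE : E.IsVectorBundle)
    (hF : F.IsVectorBundle) : (E.sum F).IsVectorBundle where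
  continuous_proj := hE.continuous_proj.comp (continuous_sum_fst E F)
  locally_trivial x := by
    obtain ⟨U, hU, hxU, ι, _, φ, hφ, hφ'⟩ := hE.locally_trivial x
    obtain ⟨U', hU', hxU', κ, _, ψ, hψ, hψ'⟩ := hF.locally_trivial x
    refine ⟨U ∩ U', hU.inter hU', ⟨hxU, hxU'⟩, ι ⊕ κ, inferInstance, fun y =>
      ((φ ⟨y, y.2.1⟩).prodCongr (ψ ⟨y, y.2.2⟩)).trans
        (LinearEquiv.sumArrowLequivProdArrow ι κ ℂ ℂ).symm, ?_, ?_⟩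
    · refine continuous_pi fun i => ?_
      rcases i with i | i
      · exact (continuous_apply i).comp (hφ.comp
          (((continuous_sum_fst E F).comp continuous_subtype_val).subtype_mk fun t => t.2.1))
      · exact (continuous_apply i).comp (hψ.comp
          (((continuous_sum_snd E F).comp continuous_subtype_val).subtype_mk fun t => t.2.2))
    · refine (isInducing_sum E F).continuous_iff.2 (Continuous.prodMk ?_ ?_)
      · exact hφ'.comp (Continuous.prodMk
          (f := fun s : ↥(U ∩ U') × (ι ⊕ κ → ℂ) => (⟨s.1.1, s.1.2.1⟩ : U))
          (g := fun s i => s.2 (Sum.inl i)) (by fun_prop) (by fun_prop))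
      · exact hψ'.comp (Continuous.prodMk
          (f := fun s : ↥(U ∩ U') × (ι ⊕ κ → ℂ) => (⟨s.1.1, s.1.2.2⟩ : U'))
          (g := fun s i => s.2 (Sum.inr i)) (by fun_prop) (by fun_prop))
  continuous_act := (isInducing_sum E F).continuous_iff.2 (Continuous.prodMk
    (hE.continuous_act.comp (continuous_fst.prodMk
      ((continuous_sum_fst E F).comp continuous_snd)))
    (hF.continuous_act.comp (continuous_fst.prodMk
      ((continuous_sum_snd E F).comp continuous_snd))))

theorem IsVectorBundle.tensor (W : FinRep.{v} Q) {E : Family.{u, v} p X}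
    [ContinuousConstSMul Q X] (hp : IsLocallyConstant p)
    (hE : E.IsVectorBundle) : (E.tensor W).IsVectorBundle where
  continuous_proj := continuous_tensor_fst W E
  locally_trivial x := by
    obtain ⟨U, hU, hxU, ι, _, φ, hφ, hφ'⟩ := hE.locally_trivial x
    let b := Module.finBasis ℂ W.carrier
    refine ⟨U, hU, hxU, Fin (Module.finrank ℂ W.carrier) × ι, inferInstance, fun y =>
      tensorEquiv b (φ y), ?_, ?_⟩
    · refine continuous_pi fun s => ?_
      exact (continuous_apply s.2).comp (hφ.comp
        (((continuous_tensor_contract W E (b.coord s.1)).comp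
          continuous_subtype_val).subtype_mk fun t => t.2))
    · refine (isInducing_tensor W E).continuous_iff.2 (Continuous.prodMk ?_ ?_)
      · exact continuous_subtype_val.comp continuous_fst
      · refine continuous_pi fun ψ => ?_
        have hs : Continuous fun s : U × (Fin (Module.finrank ℂ W.carrier) × ι → ℂ) =>
            fun i => ∑ k, ψ (b k) * s.2 (k, i) :=
          continuous_pi fun i => continuous_finsetSum _ fun k _ => continuous_const.mul
            ((continuous_apply (k, i)).comp continuous_snd)
        have : Continuous fun s : U × (Fin (Module.finrank ℂ W.carrier) × ι → ℂ) =>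
            E.pt s.1 ((φ s.1).symm (fun i => ∑ k, ψ (b k) * s.2 (k, i))) :=
          hφ'.comp (Continuous.prodMk continuous_fst hs)
        convert this using 2 with s
        change E.pt s.1 (contract ψ (∑ k, b k ⊗ₜ[ℂ] (φ s.1).symm fun i => s.2 (k, i))) = _
        congr 1
        apply (φ s.1).injective
        ext i
        simp
  continuous_act := by
    refine (isInducing_tensor W E).continuous_iff.2 (Continuous.prodMk ?_ ?_)
    · exact (continuous_baseAct hp).comp
        (continuous_fst.prodMk ((continuous_tensor_fst W E).comp continuous_snd))
    · refine continuous_pi fun φ => ?_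
      have := continuous_of_locallyConstant hp (S := (E.tensor W).Tot)
        (fun q s => E.totAct (s.1, E.pt s.2.1 (contract (φ ∘ₗ W.rep q) s.2.2)))
        (fun q => hE.continuous_act.comp (continuous_fst.prodMk
          ((continuous_tensor_contract W E _).comp continuous_snd)))
      convert this using 2 with s
      refine congrArg (E.pt _) ?_
      exact tmul_equiv_of_tmul
        (f := contract φ ∘ₗ TensorProduct.map (W.rep (p s.1)) (E.act s.1 rfl))
        (g := E.act s.1 rfl ∘ₗ contract (φ ∘ₗ W.rep (p s.1)))
        (fun a b => by simp) s.2.2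

theorem IsVectorBundle.pullback {Y : Type u} [MulAction Q Y] [TopologicalSpace Y]
    [ContinuousConstSMul Q X] (hp : IsLocallyConstant p) (f : EqMap Q X Y)
    {E : Family.{u, v} p Y} (hE : E.IsVectorBundle) : (E.pullback f).IsVectorBundle where
  continuous_proj := continuous_fst.comp (isInducing_pullback f E).continuous
  locally_trivial x := by
    obtain ⟨U, hU, hxU, ι, _, φ, hφ, hφ'⟩ := hE.locally_trivial (f.toFun x)
    refine ⟨f.toFun ⁻¹' U, hU.preimage f.continuous, hxU, ι, inferInstance,
      fun y => φ ⟨f.toFun y, y.2⟩, ?_, ?_⟩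
    · exact hφ.comp (((continuous_snd.comp (isInducing_pullback f E).continuous).comp
        continuous_subtype_val).subtype_mk fun t => t.2)
    · refine (isInducing_pullback f E).continuous_iff.2 (Continuous.prodMk
        (continuous_subtype_val.comp continuous_fst) ?_)
      exact hφ'.comp (Continuous.prodMk
        (((f.continuous.comp continuous_subtype_val).comp continuous_fst).subtype_mk
          fun s : ↥(f.toFun ⁻¹' U) × (ι → ℂ) => s.1.2) continuous_snd)
  continuous_act := by
    refine (isInducing_pullback f E).continuous_iff.2 (Continuous.prodMk ?_ ?_)
    · exact (continuous_baseAct hp).comp (continuous_fst.prodMk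
        ((continuous_fst.comp (isInducing_pullback f E).continuous).comp continuous_snd))
    · have := hE.continuous_act.comp (continuous_fst.prodMk
        ((continuous_snd.comp (isInducing_pullback f E).continuous).comp
          (continuous_snd (X := Γ))))
      convert this using 2 with s
      have key : ∀ (y : Y) (h₁ : p s.1 • f.toFun s.2.1 = y),
          E.pt y (E.act s.1 h₁ s.2.2) = E.totAct (s.1, E.pt (f.toFun s.2.1) s.2.2) := by
        rintro y rfl; rfl
      exact key _ _

end Family

end Operations

end Families

section KTheory

/-- The data selecting a type of equivariant bundles over `Q`-spaces: a topological group `grp`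
with a locally constant homomorphism to `Q` (through which it acts on `Q`-spaces), and a condition
on the representation of the kernel on the fibres, stable under direct sums and under tensor
products with trivial representations. -/
structure Kind (Q : Type w) [Group Q] where
  grp : Type w'
  [group : Group grp]
  [top : TopologicalSpace grp]
  proj : grp →* Q
  locConst : IsLocallyConstant proj
  cond : ∀ (F : Type v) [AddCommGroup F] [Module ℂ F], Representation ℂ proj.ker F → Prop
  cond_zero : ∀ σ : Representation ℂ proj.ker PUnit.{v + 1}, cond PUnit σ
  cond_sum : ∀ (F F' : Type v) [AddCommGroup F] [Module ℂ F] [AddCommGroup F'] [Module ℂ F']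
    (σ : Representation ℂ proj.ker F) (σ' : Representation ℂ proj.ker F'),
    cond F σ → cond F' σ' → cond (F × F') (σ.prod σ')
  cond_tensor : ∀ (W F : Type v) [AddCommGroup W] [Module ℂ W] [FiniteDimensional ℂ W]
    [AddCommGroup F] [Module ℂ F] (σ : Representation ℂ proj.ker F),
    cond F σ → cond (W ⊗[ℂ] F) (Representation.tprod 1 σ)

attribute [instance] Kind.group Kind.top

variable {Q : Type w} [Group Q]

/-- An equivariant vector bundle over `X` of the given kind. -/
structure Bundle (𝒯 : Kind.{v, w, w'} Q) (X : Type u) [TopologicalSpace X] [MulAction Q X] where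
  fam : Family.{u, v} 𝒯.proj X
  isVB : fam.IsVectorBundle
  cond : ∀ x, 𝒯.cond (fam.fiber x) (fam.kerRep x)

instance Bundle.setoid (𝒯 : Kind.{v, w, w'} Q) (X : Type u) [TopologicalSpace X]
    [MulAction Q X] : Setoid (Bundle.{u, v} 𝒯 X) where
  r E F := E.fam.Iso F.fam
  iseqv := ⟨fun E => Family.Iso.refl _, Family.Iso.symm, Family.Iso.trans⟩

/-- The set of isomorphism classes of bundles of the given kind. -/
def Vec (𝒯 : Kind.{v, w, w'} Q) (X : Type u) [TopologicalSpace X] [MulAction Q X] :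
    Type (max u (v + 1) w') :=
  Quotient (Bundle.setoid.{u, v} 𝒯 X)

variable (𝒯 : Kind.{v, w, w'} Q)

namespace Bundle

section
variable {𝒯}
variable {X : Type u} [TopologicalSpace X] [MulAction Q X]

/-- The class of a bundle. -/
def cls (E : Bundle.{u, v} 𝒯 X) : Vec 𝒯 X := Quotient.mk _ E

theorem cls_eq {E F : Bundle.{u, v} 𝒯 X} (e : ∀ x, E.fam.fiber x ≃ₗ[ℂ] F.fam.fiber x)
    (he : ∀ (γ : 𝒯.grp) (x y : X) (h : 𝒯.proj γ • x = y) (a : E.fam.fiber x),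
      e y (E.fam.act γ h a) = F.fam.act γ h (e x a))
    (hc : Continuous (Family.totMap (E := E.fam) (F := F.fam) fun x => (e x).toLinearMap)) :
    E.cls = F.cls :=
  Quotient.sound (Family.iso_of_continuous E.isVB F.isVB e he hc)

/-- Whitney sum. -/
def sum (E F : Bundle.{u, v} 𝒯 X) : Bundle.{u, v} 𝒯 X where
  fam := E.fam.sum F.fam
  isVB := E.isVB.sum F.isVB
  cond x := 𝒯.cond_sum _ _ _ _ (E.cond x) (F.cond x)

variable [ContinuousConstSMul Q X]

variable (𝒯 X) in
/-- The zero bundle. -/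
def zero : Bundle.{u, v} 𝒯 X where
  fam := Family.zero _ _
  isVB := Family.isVectorBundle_zero 𝒯.locConst
  cond x := 𝒯.cond_zero _

/-- Tensor product with a representation of `Q`. -/
def tensor (W : FinRep.{v} Q) (E : Bundle.{u, v} 𝒯 X) : Bundle.{u, v} 𝒯 X where
  fam := E.fam.tensor W
  isVB := E.isVB.tensor W 𝒯.locConst
  cond x := by
    have h : (E.fam.tensor W).kerRep x = Representation.tprod 1 (E.fam.kerRep x) := by
      ext1 k
      have hk : 𝒯.proj k = 1 := k.2
      change TensorProduct.map (W.rep (𝒯.proj k)) _ = TensorProduct.map 1 _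
      rw [hk, map_one]; rfl
    have := 𝒯.cond_tensor W.carrier _ _ (E.cond x)
    rw [← h] at this
    exact this

/-- Pullback. -/
def pullback {Y : Type u} [TopologicalSpace Y] [MulAction Q Y] (f : EqMap Q X Y)
    (E : Bundle.{u, v} 𝒯 Y) : Bundle.{u, v} 𝒯 X where
  fam := E.fam.pullback f
  isVB := E.isVB.pullback 𝒯.locConst f
  cond x := E.cond (f.toFun x)

end

end Bundle

/-- A zero space is isomorphic to the standard one. -/
def zeroEquiv {F : Type v} [AddCommGroup F] [Module ℂ F] (h : ∀ t : F, 0 = t) :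
    F ≃ₗ[ℂ] PUnit.{v + 1} where
  toFun _ := PUnit.unit
  map_add' _ _ := rfl
  map_smul' _ _ := rfl
  invFun _ := 0
  left_inv := h
  right_inv _ := rfl

namespace Vec

variable {X : Type u} [TopologicalSpace X] [MulAction Q X]

variable {𝒯}

open Family

instance : Add (Vec.{u, v} 𝒯 X) :=
  ⟨Quotient.map₂ Bundle.sum fun E E' ⟨e, h, hc, hc'⟩ F F' ⟨f, h', _, _⟩ => by
    rename_i hf hf'
    refine iso_of_continuous (E.sum F).isVB (E'.sum F').isVB (fun x => (e x).prodCongr (f x))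
      (fun γ x y hxy a => Prod.ext (h γ x y hxy a.1) (h' γ x y hxy a.2)) ?_
    exact (isInducing_sum _ _).continuous_iff.2
      ((hc.comp (continuous_sum_fst _ _)).prodMk (hf.comp (continuous_sum_snd _ _)))⟩

theorem cls_add (E F : Bundle.{u, v} 𝒯 X) : E.cls + F.cls = (E.sum F).cls := rfl

theorem add_comm' (a b : Vec.{u, v} 𝒯 X) : a + b = b + a := by
  induction a, b using Quotient.inductionOn₂ with
  | _ E F =>
    exact Bundle.cls_eq (E := E.sum F) (F := F.sum E) (fun x => LinearEquiv.prodComm ℂ _ _)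
      (fun _ _ _ _ _ => rfl) ((isInducing_sum _ _).continuous_iff.2
        ((continuous_sum_snd _ _).prodMk (continuous_sum_fst _ _)))

variable [ContinuousConstSMul Q X]

instance : Zero (Vec.{u, v} 𝒯 X) := ⟨(Bundle.zero 𝒯 X).cls⟩

theorem zero_def : (0 : Vec.{u, v} 𝒯 X) = (Bundle.zero 𝒯 X).cls := rfl

instance : AddCommMonoid (Vec.{u, v} 𝒯 X) where
  nsmul := nsmulRec
  add_comm := add_comm'
  add_assoc a b c := by
    induction a, b, c using Quotient.inductionOn₃ with
    | _ E F H =>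
      exact Bundle.cls_eq (E := (E.sum F).sum H) (F := E.sum (F.sum H))
        (fun x => LinearEquiv.prodAssoc ℂ _ _ _)
        (fun _ _ _ _ _ => rfl) ((isInducing_sum _ _).continuous_iff.2
        (((continuous_sum_fst _ _).comp (continuous_sum_fst _ _)).prodMk
          ((isInducing_sum _ _).continuous_iff.2
            (((continuous_sum_snd _ _).comp (continuous_sum_fst _ _)).prodMk
              (continuous_sum_snd _ _)))))
  zero_add a := by
    induction a using Quotient.ind with
    | _ E =>
      exact Bundle.cls_eq (E := (Bundle.zero 𝒯 X).sum E) (F := E)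
        (fun x => (LinearEquiv.uniqueProd :
          (PUnit.{v + 1} × E.fam.fiber x) ≃ₗ[ℂ] E.fam.fiber x))
        (fun _ _ _ _ _ => rfl) (continuous_sum_snd _ _)
  add_zero a := by
    rw [add_comm']
    induction a using Quotient.ind with
    | _ E =>
      exact Bundle.cls_eq (E := (Bundle.zero 𝒯 X).sum E) (F := E)
        (fun x => (LinearEquiv.uniqueProd :
          (PUnit.{v + 1} × E.fam.fiber x) ≃ₗ[ℂ] E.fam.fiber x))
        (fun _ _ _ _ _ => rfl) (continuous_sum_snd _ _)

instance : SMul (RepClass.{v} Q) (Vec.{u, v} 𝒯 X) :=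
  ⟨Quotient.map₂ Bundle.tensor fun W W' ⟨e, h⟩ E E' ⟨f, h', hf, hf'⟩ => by
    refine iso_of_continuous (E.tensor W).isVB (E'.tensor W').isVB
      (fun x => TensorProduct.congr e (f x)) (fun γ x y hxy a => ?_) ?_
    · exact tmul_equiv_of_tmul
        (f := (TensorProduct.congr e (f y)).toLinearMap ∘ₗ
          TensorProduct.map (W.rep (𝒯.proj γ)) (E.fam.act γ hxy))
        (g := TensorProduct.map (W'.rep (𝒯.proj γ)) (E'.fam.act γ hxy) ∘ₗ
          (TensorProduct.congr e (f x)).toLinearMap) (fun a b => by simp [h, h']) a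
    · refine (isInducing_tensor _ _).continuous_iff.2
        ((continuous_tensor_fst _ _).prodMk (continuous_pi fun φ => ?_))
      refine Continuous.congr (hf.comp (continuous_tensor_contract W E.fam (φ ∘ₗ e.toLinearMap))) fun t =>
        congrArg (E'.fam.pt _) (Eq.symm ?_)
      exact tmul_equiv_of_tmul
        (f := contract φ ∘ₗ (TensorProduct.congr e (f t.1)).toLinearMap)
        (g := (f t.1).toLinearMap ∘ₗ contract (φ ∘ₗ e.toLinearMap))
        (fun a b => by simp) t.2⟩

theorem smul_cls (W : FinRep.{v} Q) (E : Bundle.{u, v} 𝒯 X) :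
    (show RepClass.{v} Q from Quotient.mk _ W) • E.cls = (E.tensor W).cls := rfl

instance : Module (RepClass.{v} Q) (Vec.{u, v} 𝒯 X) where
  one_smul a := by
    induction a using Quotient.ind with
    | _ E =>
      refine Bundle.cls_eq (E := E.tensor (FinRep.triv Q)) (F := E)
        (fun x => (TensorProduct.congr ULift.moduleEquiv (LinearEquiv.refl _ _)).trans
          (TensorProduct.lid ℂ _)) (fun γ x y hxy a => ?_) ?_
      · exact tmul_equiv_of_tmul
          (f := ((TensorProduct.congr ULift.moduleEquiv (LinearEquiv.refl _ _)).trans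
            (TensorProduct.lid ℂ _)).toLinearMap ∘ₗ
            TensorProduct.map ((FinRep.triv.{v} Q).rep (𝒯.proj γ)) (E.fam.act γ hxy))
          (g := E.fam.act γ hxy ∘ₗ ((TensorProduct.congr ULift.moduleEquiv
            (LinearEquiv.refl _ _)).trans (TensorProduct.lid ℂ _)).toLinearMap)
          (fun a b => by simp) a
      · refine Continuous.congr (continuous_tensor_contract (FinRep.triv Q) E.fam
          (ULift.moduleEquiv.toLinearMap)) fun t =>
          congrArg (E.fam.pt _) (Eq.symm ?_)
        exact tmul_equiv_of_tmul
          (f := ((TensorProduct.congr ULift.moduleEquiv (LinearEquiv.refl _ _)).trans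
            (TensorProduct.lid ℂ _)).toLinearMap)
          (g := contract ULift.moduleEquiv.toLinearMap) (fun a b => by simp) t.2
  mul_smul w w' a := by
    induction w, w', a using Quotient.inductionOn₃ with
    | _ W W' E =>
      refine Bundle.cls_eq (E := E.tensor (W.tensor W')) (F := (E.tensor W').tensor W)
        (fun x => TensorProduct.assoc ℂ _ _ _) (fun γ x y hxy a => ?_) ?_
      · refine DFunLike.congr_fun (f := (TensorProduct.assoc ℂ _ _ _).toLinearMap ∘ₗ
          TensorProduct.map ((W.tensor W').rep (𝒯.proj γ)) (E.fam.act γ hxy))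
          (g := TensorProduct.map (W.rep (𝒯.proj γ))
            (TensorProduct.map (W'.rep (𝒯.proj γ)) (E.fam.act γ hxy)) ∘ₗ
            (TensorProduct.assoc ℂ _ _ _).toLinearMap) ?_ a
        refine TensorProduct.ext_threefold fun a b c => ?_
        simp
      · refine (isInducing_tensor _ _).continuous_iff.2
          ((continuous_tensor_fst _ _).prodMk (continuous_pi fun φ => ?_))
        refine (isInducing_tensor _ _).continuous_iff.2
          ((continuous_tensor_fst _ _).prodMk (continuous_pi fun ψ => ?_))
        refine Continuous.congr (continuous_tensor_contract (W.tensor W') E.fam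
          (LinearMap.mul' ℂ ℂ ∘ₗ TensorProduct.map φ ψ)) fun t =>
          congrArg (E.fam.pt _) (Eq.symm ?_)
        refine DFunLike.congr_fun (f := contract ψ ∘ₗ contract φ ∘ₗ
          (TensorProduct.assoc ℂ W.carrier W'.carrier (E.fam.fiber t.1)).toLinearMap)
          (g := contract (LinearMap.mul' ℂ ℂ ∘ₗ TensorProduct.map φ ψ)) ?_ t.2
        refine TensorProduct.ext_threefold fun a b c => ?_
        simp [mul_smul]
  smul_zero w := by
    induction w using Quotient.ind with
    | _ W =>
      have hs : ∀ t : W.carrier ⊗[ℂ] PUnit.{v + 1}, 0 = t := fun t =>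
        tmul_equiv_of_tmul (W' := PUnit) (f := 0) (g := LinearMap.id)
          (fun a b => by rw [Subsingleton.elim b 0]; simp) t
      refine Bundle.cls_eq (E := (Bundle.zero 𝒯 X).tensor W) (F := Bundle.zero 𝒯 X)
        (fun x => zeroEquiv hs) (fun _ _ _ _ _ => rfl) ?_
      exact isInducing_zero.continuous_iff.2 (continuous_tensor_fst _ _)
  zero_smul a := by
    induction a using Quotient.ind with
    | _ E =>
      have hs : ∀ x, ∀ t : PUnit.{v + 1} ⊗[ℂ] E.fam.fiber x, 0 = t := fun x t =>
        tmul_equiv_of_tmul (W := PUnit) (f := 0) (g := LinearMap.id)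
          (fun a b => by rw [Subsingleton.elim a 0]; simp) t
      refine Bundle.cls_eq (E := E.tensor (FinRep.zero Q)) (F := Bundle.zero 𝒯 X)
        (fun x => zeroEquiv (hs x)) (fun _ _ _ _ _ => rfl) ?_
      exact isInducing_zero.continuous_iff.2 (continuous_tensor_fst _ _)
  smul_add w a b := by
    induction w, a, b using Quotient.inductionOn₃ with
    | _ W E F =>
      refine Bundle.cls_eq (E := (E.sum F).tensor W) (F := (E.tensor W).sum (F.tensor W))
        (fun x => TensorProduct.prodRight ℂ ℂ _ _ _) (fun γ x y hxy a => ?_) ?_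
      · exact tmul_equiv_of_tmul
          (f := (TensorProduct.prodRight ℂ ℂ _ _ _).toLinearMap ∘ₗ
            TensorProduct.map (W.rep (𝒯.proj γ)) ((E.fam.act γ hxy).prodMap (F.fam.act γ hxy)))
          (g := ((TensorProduct.map (W.rep (𝒯.proj γ)) (E.fam.act γ hxy)).prodMap
            (TensorProduct.map (W.rep (𝒯.proj γ)) (F.fam.act γ hxy))) ∘ₗ
            (TensorProduct.prodRight ℂ ℂ _ _ _).toLinearMap) (fun a b => by simp) a
      · refine (isInducing_sum _ _).continuous_iff.2 (Continuous.prodMk ?_ ?_)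
        · refine (isInducing_tensor _ _).continuous_iff.2
            ((continuous_tensor_fst _ _).prodMk (continuous_pi fun φ => ?_))
          refine Continuous.congr ((continuous_sum_fst _ _).comp
            (continuous_tensor_contract W (E.fam.sum F.fam) φ)) fun t =>
            congrArg (E.fam.pt _) (Eq.symm ?_)
          exact tmul_equiv_of_tmul
            (f := contract φ ∘ₗ LinearMap.fst ℂ _ _ ∘ₗ
              (TensorProduct.prodRight ℂ ℂ W.carrier (E.fam.fiber t.1)
                (F.fam.fiber t.1)).toLinearMap)
            (g := LinearMap.fst ℂ _ _ ∘ₗ contract φ) (fun a b => by simp) t.2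
        · refine (isInducing_tensor _ _).continuous_iff.2
            ((continuous_tensor_fst _ _).prodMk (continuous_pi fun φ => ?_))
          refine Continuous.congr ((continuous_sum_snd _ _).comp
            (continuous_tensor_contract W (E.fam.sum F.fam) φ)) fun t =>
            congrArg (F.fam.pt _) (Eq.symm ?_)
          exact tmul_equiv_of_tmul
            (f := contract φ ∘ₗ LinearMap.snd ℂ _ _ ∘ₗ
              (TensorProduct.prodRight ℂ ℂ W.carrier (E.fam.fiber t.1)
                (F.fam.fiber t.1)).toLinearMap)
            (g := LinearMap.snd ℂ _ _ ∘ₗ contract φ) (fun a b => by simp) t.2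
  add_smul w w' a := by
    induction w, w', a using Quotient.inductionOn₃ with
    | _ W W' E =>
      refine Bundle.cls_eq (E := E.tensor (W.sum W')) (F := (E.tensor W).sum (E.tensor W'))
        (fun x => TensorProduct.prodLeft ℂ ℂ _ _ _) (fun γ x y hxy a => ?_) ?_
      · exact tmul_equiv_of_tmul
          (f := (TensorProduct.prodLeft ℂ ℂ _ _ _).toLinearMap ∘ₗ
            TensorProduct.map ((W.sum W').rep (𝒯.proj γ)) (E.fam.act γ hxy))
          (g := ((TensorProduct.map (W.rep (𝒯.proj γ)) (E.fam.act γ hxy)).prodMap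
            (TensorProduct.map (W'.rep (𝒯.proj γ)) (E.fam.act γ hxy))) ∘ₗ
            (TensorProduct.prodLeft ℂ ℂ _ _ _).toLinearMap) (fun a b => by obtain ⟨a₁, a₂⟩ := a; simp) a
      · refine (isInducing_sum _ _).continuous_iff.2 (Continuous.prodMk ?_ ?_)
        · refine (isInducing_tensor _ _).continuous_iff.2
            ((continuous_tensor_fst _ _).prodMk (continuous_pi fun φ => ?_))
          refine Continuous.congr (continuous_tensor_contract (W.sum W') E.fam (φ ∘ₗ LinearMap.fst ℂ _ _)) fun t =>
            congrArg (E.fam.pt _) (Eq.symm ?_)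
          exact tmul_equiv_of_tmul
            (f := contract φ ∘ₗ LinearMap.fst ℂ _ _ ∘ₗ
              (TensorProduct.prodLeft ℂ ℂ W.carrier W'.carrier (E.fam.fiber t.1)).toLinearMap)
            (g := contract (φ ∘ₗ LinearMap.fst ℂ _ _)) (fun a b => by obtain ⟨a₁, a₂⟩ := a; simp) t.2
        · refine (isInducing_tensor _ _).continuous_iff.2
            ((continuous_tensor_fst _ _).prodMk (continuous_pi fun φ => ?_))
          refine Continuous.congr (continuous_tensor_contract (W.sum W') E.fam (φ ∘ₗ LinearMap.snd ℂ _ _)) fun t =>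
            congrArg (E.fam.pt _) (Eq.symm ?_)
          exact tmul_equiv_of_tmul
            (f := contract φ ∘ₗ LinearMap.snd ℂ _ _ ∘ₗ
              (TensorProduct.prodLeft ℂ ℂ W.carrier W'.carrier (E.fam.fiber t.1)).toLinearMap)
            (g := contract (φ ∘ₗ LinearMap.snd ℂ _ _)) (fun a b => by obtain ⟨a₁, a₂⟩ := a; simp) t.2

end Vec

end KTheory

section KGroups

variable {Q : Type w} [Group Q] (𝒯 : Kind.{v, w, w'} Q)

/-- The Grothendieck group of the semigroup of isomorphism classes of bundles of the given kind. -/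
def K0 (X : Type u) [TopologicalSpace X] [MulAction Q X] [ContinuousConstSMul Q X] :
    Type (max u (v + 1) w') :=
  Algebra.GrothendieckAddGroup (Vec.{u, v} 𝒯 X)

section
variable (X : Type u) [TopologicalSpace X] [MulAction Q X] [ContinuousConstSMul Q X]

instance : AddCommGroup (K0.{u, v} 𝒯 X) :=
  inferInstanceAs (AddCommGroup (Algebra.GrothendieckAddGroup (Vec.{u, v} 𝒯 X)))

/-- The `R(Q)`-module structure, given by the tensor product with representations. -/
instance : Module (RepRing.{v} Q) (K0.{u, v} 𝒯 X) := grothModule (Vec.{u, v} 𝒯 X)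

variable {X}

/-- The class `[E]` of a bundle in `K`-theory. -/
def K0.of {𝒯 : Kind.{v, w, w'} Q} (E : Bundle.{u, v} 𝒯 X) : K0.{u, v} 𝒯 X :=
  gOf (M := Vec.{u, v} 𝒯 X) E.cls

end

section Pullback

variable {X Y Z : Type u} [TopologicalSpace X] [MulAction Q X] [ContinuousConstSMul Q X]
  [TopologicalSpace Y] [MulAction Q Y] [ContinuousConstSMul Q Y]
  [TopologicalSpace Z] [MulAction Q Z] [ContinuousConstSMul Q Z]

/-- Composition of equivariant maps. -/
def EqMap.comp (g : EqMap Q Y Z) (f : EqMap Q X Y) : EqMap Q X Z where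
  toFun := g.toFun ∘ f.toFun
  continuous := g.continuous.comp f.continuous
  map_smul q x := by simp [f.map_smul, g.map_smul]

open Family

variable {𝒯}

theorem Family.continuous_pullback {p : 𝒯.grp →* Q} (f : EqMap Q X Y) (E : Family.{u, v} p Y) :
    Continuous fun t : (E.pullback f).Tot => E.pt (f.toFun t.1) t.2 :=
  continuous_snd.comp (isInducing_pullback f E).continuous

theorem Family.continuous_pullback_fst {p : 𝒯.grp →* Q} (f : EqMap Q X Y)
    (E : Family.{u, v} p Y) : Continuous (E.pullback f).proj :=
  continuous_fst.comp (isInducing_pullback f E).continuous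

/-- Pullback of isomorphism classes. -/
def Vec.pull (f : EqMap Q X Y) : Vec.{u, v} 𝒯 Y → Vec.{u, v} 𝒯 X :=
  Quotient.map (Bundle.pullback f) fun E F ⟨e, h, hc, hc'⟩ => by
    refine iso_of_continuous (E.pullback f).isVB (F.pullback f).isVB (fun x => e (f.toFun x))
      (fun γ x y hxy a => h _ _ _ _ a) ?_
    exact (isInducing_pullback _ _).continuous_iff.2
      ((continuous_pullback_fst _ _).prodMk (hc.comp (continuous_pullback _ _)))

/-- Pullback of isomorphism classes as a linear map. -/
def Vec.pullHom (f : EqMap Q X Y) : Vec.{u, v} 𝒯 Y →ₗ[RepClass.{v} Q] Vec.{u, v} 𝒯 X where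
  toFun := Vec.pull f
  map_add' a b := by
    induction a, b using Quotient.inductionOn₂ with
    | _ E F =>
      refine Bundle.cls_eq (E := (E.sum F).pullback f) (F := (E.pullback f).sum (F.pullback f))
        (fun x => LinearEquiv.refl _ _) (fun _ _ _ _ _ => rfl)
        ((isInducing_sum _ _).continuous_iff.2 (Continuous.prodMk ?_ ?_))
      · exact (isInducing_pullback _ _).continuous_iff.2 ((continuous_pullback_fst _ _).prodMk
          ((continuous_sum_fst _ _).comp (continuous_pullback _ _)))
      · exact (isInducing_pullback _ _).continuous_iff.2 ((continuous_pullback_fst _ _).prodMk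
          ((continuous_sum_snd _ _).comp (continuous_pullback _ _)))
  map_smul' w a := by
    induction w, a using Quotient.inductionOn₂ with
    | _ W E =>
      refine Bundle.cls_eq (E := (E.tensor W).pullback f) (F := (E.pullback f).tensor W)
        (fun x => LinearEquiv.refl _ _) (fun _ _ _ _ _ => rfl)
        ((isInducing_tensor _ _).continuous_iff.2
          ((continuous_pullback_fst _ _).prodMk (continuous_pi fun φ => ?_)))
      exact (isInducing_pullback _ _).continuous_iff.2 ((continuous_pullback_fst _ _).prodMk
          ((continuous_tensor_contract W E.fam φ).comp (continuous_pullback _ _)))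

theorem Vec.pull_comp (g : EqMap Q Y Z) (f : EqMap Q X Y) (a : Vec.{u, v} 𝒯 Z) :
    Vec.pull (g.comp f) a = Vec.pull f (Vec.pull g a) := by
  induction a using Quotient.ind with
  | _ E =>
    refine Bundle.cls_eq (E := E.pullback (g.comp f)) (F := (E.pullback g).pullback f)
      (fun x => LinearEquiv.refl _ _) (fun _ _ _ _ _ => rfl) ?_
    refine (isInducing_pullback _ _).continuous_iff.2
      ((continuous_pullback_fst _ _).prodMk ?_)
    exact (isInducing_pullback _ _).continuous_iff.2
      ((f.continuous.comp (continuous_pullback_fst _ _)).prodMk (continuous_pullback _ _))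

/-- The induced map `f^*` in `K`-theory. -/
def K0.pull (f : EqMap Q X Y) : K0.{u, v} 𝒯 Y →ₗ[RepRing.{v} Q] K0.{u, v} 𝒯 X where
  toFun := grothMap (Vec.pullHom (𝒯 := 𝒯) f).toAddMonoidHom
  map_add' := map_add (grothMap (Vec.pullHom (𝒯 := 𝒯) f).toAddMonoidHom)
  map_smul' r a := grothMap_smul (Vec.pullHom (𝒯 := 𝒯) f) r a

theorem K0.pull_of (f : EqMap Q X Y) (E : Bundle.{u, v} 𝒯 Y) :
    K0.pull f (K0.of E) = K0.of (E.pullback f) :=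
  grothMap_of _ _

theorem K0.pull_comp (g : EqMap Q Y Z) (f : EqMap Q X Y) (a : K0.{u, v} 𝒯 Z) :
    K0.pull (g.comp f) a = K0.pull f (K0.pull g a) := by
  change grothMap (Vec.pullHom (𝒯 := 𝒯) (g.comp f)).toAddMonoidHom a =
    grothMap (Vec.pullHom (𝒯 := 𝒯) f).toAddMonoidHom
      (grothMap (Vec.pullHom (𝒯 := 𝒯) g).toAddMonoidHom a)
  induction a using groth_induction with
  | add a a' h h' => simp only [map_add, h, h']
  | neg a h => simp only [map_neg, h]
  | of m =>
    rw [grothMap_of, grothMap_of, grothMap_of]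
    exact congrArg _ (Vec.pull_comp g f m)

end Pullback

section Suspension

/-- The `n`-fold reduced suspension `Σⁿ X₊ = Sⁿ ∧ X₊` of the space `X` with a disjoint base point,
for compact Hausdorff `X`: the one-point compactification of `ℝⁿ × X`, the base point being the
point at infinity. -/
def SuspPlus (n : ℕ) (X : Type u) : Type u := OnePoint ((Fin n → ℝ) × X)

variable (n : ℕ) (X : Type u) [TopologicalSpace X]

instance : TopologicalSpace (SuspPlus n X) :=
  inferInstanceAs (TopologicalSpace (OnePoint ((Fin n → ℝ) × X)))

instance : CompactSpace (SuspPlus n X) :=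
  inferInstanceAs (CompactSpace (OnePoint ((Fin n → ℝ) × X)))

instance [CompactSpace X] [T2Space X] : T2Space (SuspPlus n X) :=
  inferInstanceAs (T2Space (OnePoint ((Fin n → ℝ) × X)))

/-- The group acts on `Σⁿ X₊` through `X`. -/
instance [MulAction Q X] : MulAction Q (SuspPlus n X) where
  smul q := OnePoint.map (Prod.map id (q • ·))
  one_smul t := by
    change OnePoint.map (Prod.map id ((1 : Q) • ·)) t = t
    have : (Prod.map id ((1 : Q) • ·) : (Fin n → ℝ) × X → (Fin n → ℝ) × X) = id := by
      ext1 s; simp [Prod.map]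
    rw [this, OnePoint.map_id]; rfl
  mul_smul q r t := by
    change OnePoint.map (Prod.map id ((q * r) • ·)) t
      = OnePoint.map (Prod.map id (q • ·)) (OnePoint.map (Prod.map id (r • ·)) t)
    have : (Prod.map id ((q * r) • ·) : (Fin n → ℝ) × X → (Fin n → ℝ) × X)
        = Prod.map id (q • ·) ∘ Prod.map id (r • ·) := by
      ext1 s; simp [Prod.map, mul_smul]
    rw [this, OnePoint.map_comp]; rfl

instance [MulAction Q X] [ContinuousConstSMul Q X] : ContinuousConstSMul Q (SuspPlus n X) where
  continuous_const_smul q := by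
    refine OnePoint.continuous_map (by fun_prop) ?_
    let h := (Homeomorph.refl (Fin n → ℝ)).prodCongr (Homeomorph.smul q : X ≃ₜ X)
    exact (Filter.hasBasis_coclosedCompact.tendsto_iff Filter.hasBasis_coclosedCompact).2
      fun K hK => ⟨h ⁻¹' K, ⟨hK.1.preimage h.continuous, h.isCompact_preimage.2 hK.2⟩,
        fun t ht => ht⟩

variable {X} {Y : Type u} [TopologicalSpace Y] [MulAction Q X] [MulAction Q Y]

/-- The map `Σⁿ X₊ → Σⁿ Y₊` induced by an equivariant map. -/
def EqMap.susp [CompactSpace X] [T2Space Y] (f : EqMap Q X Y) :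
    EqMap Q (SuspPlus n X) (SuspPlus n Y) where
  toFun := OnePoint.map (Prod.map id f.toFun)
  continuous := by
    refine OnePoint.continuous_map (continuous_id.prodMap f.continuous) ?_
    refine (Filter.hasBasis_coclosedCompact.tendsto_iff Filter.hasBasis_coclosedCompact).2
      fun K hK => ⟨Prod.map id f.toFun ⁻¹' K, ⟨?_, ?_⟩, fun t ht => ht⟩
    · exact hK.1.preimage (continuous_id.prodMap f.continuous)
    · refine IsCompact.of_isClosed_subset ((hK.2.image continuous_fst).prod isCompact_univ)
        (hK.1.preimage (continuous_id.prodMap f.continuous)) fun t ht => ?_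
      exact ⟨⟨_, ht, rfl⟩, trivial⟩
  map_smul q t := by
    change OnePoint.map _ (OnePoint.map (Prod.map id (q • ·)) t)
      = OnePoint.map (Prod.map id (q • ·)) (OnePoint.map _ t)
    induction t using OnePoint.rec with
    | infty => rfl
    | coe t => exact congrArg OnePoint.some (Prod.ext rfl (f.map_smul q t.2))

variable (Q X) in
/-- The inclusion of the base point. -/
def EqMap.base : EqMap Q PUnit.{u + 1} (SuspPlus n X) where
  toFun _ := (OnePoint.infty : OnePoint ((Fin n → ℝ) × X))
  continuous := continuous_const
  map_smul _ _ := rfl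

variable [ContinuousConstSMul Q X] [ContinuousConstSMul Q Y]

variable (X) in
/-- `Kⁿ(X)`: the reduced group of `Σⁿ X₊`, i.e. the kernel of the restriction to the base point. -/
def Kn : Submodule (RepRing.{v} Q) (K0.{u, v} 𝒯 (SuspPlus n X)) :=
  LinearMap.ker (K0.pull (EqMap.base Q n X))

/-- The induced map `f^*` on `Kⁿ`. -/
def Kn.pull [CompactSpace X] [T2Space Y] (f : EqMap Q X Y) :
    Kn.{u, v} 𝒯 n Y →ₗ[RepRing.{v} Q] Kn.{u, v} 𝒯 n X :=
  (K0.pull (f.susp n)).restrict fun a ha => by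
    have h : K0.pull (EqMap.base Q n Y) a = 0 := ha
    change K0.pull (EqMap.base Q n X) (K0.pull (f.susp n) a) = 0
    rw [← K0.pull_comp]
    exact h

end Suspension

end KGroups

section Twisted

variable {Q : Type w} [Group Q]

/-- A normalized 2-cocycle on `Q` with values in the circle group (with trivial action). -/
structure NormCocycle (Q : Type w) [Group Q] where
  toFun : Q → Q → Circle
  cocycle : ∀ q₁ q₂ q₃, toFun q₁ (q₂ * q₃) * toFun q₂ q₃ = toFun (q₁ * q₂) q₃ * toFun q₁ q₂
  one_left : ∀ q, toFun 1 q = 1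
  one_right : ∀ q, toFun q 1 = 1

/-- The central extension of `Q` by the circle defined by `α`: pairs `(q, z)` with product
`(q₁, z₁) (q₂, z₂) = (q₁ q₂, α(q₁, q₂) z₁ z₂)`. -/
@[ext] structure TwExt (α : NormCocycle Q) where
  q : Q
  z : Circle

variable (α : NormCocycle Q)

instance : Group (TwExt α) where
  mul a b := ⟨a.q * b.q, α.toFun a.q b.q * a.z * b.z⟩
  one := ⟨1, 1⟩
  inv a := ⟨a.q⁻¹, (α.toFun a.q⁻¹ a.q * a.z)⁻¹⟩
  mul_assoc a b c := TwExt.ext (mul_assoc _ _ _) (by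
    change α.toFun (a.q * b.q) c.q * (α.toFun a.q b.q * a.z * b.z) * c.z
      = α.toFun a.q (b.q * c.q) * a.z * (α.toFun b.q c.q * b.z * c.z)
    calc _ = (α.toFun (a.q * b.q) c.q * α.toFun a.q b.q) * (a.z * b.z * c.z) := by
          simp only [mul_assoc]
      _ = (α.toFun a.q (b.q * c.q) * α.toFun b.q c.q) * (a.z * b.z * c.z) := by
          rw [α.cocycle]
      _ = _ := by
          simp only [mul_assoc, mul_left_comm, mul_comm])
  one_mul a := TwExt.ext (one_mul _) (by
    change α.toFun 1 a.q * 1 * a.z = a.z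
    rw [α.one_left, one_mul, one_mul])
  mul_one a := TwExt.ext (mul_one _) (by
    change α.toFun a.q 1 * a.z * 1 = a.z
    rw [α.one_right, one_mul, mul_one])
  inv_mul_cancel a := TwExt.ext (inv_mul_cancel _) (by
    change α.toFun a.q⁻¹ a.q * (α.toFun a.q⁻¹ a.q * a.z)⁻¹ * a.z = 1
    rw [mul_inv_rev, mul_comm a.z⁻¹, ← mul_assoc, mul_inv_cancel, one_mul, inv_mul_cancel])

/-- The product topology of the discrete topology and the topology of the circle. -/
instance : TopologicalSpace (TwExt α) :=
  TopologicalSpace.induced (fun a => a.q) ⊥ ⊓ TopologicalSpace.induced (fun a => a.z) inferInstance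

/-- The projection of the central extension to `Q`. -/
def TwExt.proj : TwExt α →* Q where
  toFun a := a.q
  map_one' := rfl
  map_mul' _ _ := rfl

/-- The circle as the central subgroup of the extension. -/
def TwExt.circle (z : Circle) : (TwExt.proj α).ker := ⟨⟨1, z⟩, rfl⟩

/-- `α`-twisted `Q`-equivariant bundles: equivariant vector bundles for the central extension
defined by `α`, on which the central circle acts by multiplication by scalars. -/
def twistedKind : Kind.{v, w, w} Q where
  grp := TwExt α
  proj := TwExt.proj α
  locConst := by
    rw [IsLocallyConstant.iff_exists_open]
    intro a
    refine ⟨{b | b.q = a.q}, ?_, rfl, fun b hb => hb⟩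
    have h : IsOpen[TopologicalSpace.induced (fun a : TwExt α => a.q) (⊥ : TopologicalSpace Q)] {b | b.q = a.q} :=
      by
      let _ : TopologicalSpace Q := ⊥
      exact isOpen_induced_iff.2 ⟨{a.q}, trivial, rfl⟩
    exact (inf_le_left : (inferInstance : TopologicalSpace (TwExt α)) ≤ _) _ h
  cond F _ _ σ := ∀ (z : Circle) (f : F), σ (TwExt.circle α z) f = (z : ℂ) • f
  cond_zero σ z f := rfl
  cond_sum F F' _ _ _ _ σ σ' h h' z f := Prod.ext (h z f.1) (h' z f.2)
  cond_tensor W F _ _ _ _ _ σ h z f :=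
    tmul_equiv_of_tmul (f := TensorProduct.map 1 (σ (TwExt.circle α z)))
      (g := (z : ℂ) • LinearMap.id) (fun a b => by simp [h]) f

end Twisted

section Isotypic

variable {G : Type w} [Group G] {A : Subgroup G}
variable {V : Type v} [NormedAddCommGroup V] [InnerProductSpace ℂ V]

/-- The linear representation underlying a unitary representation `A → U(V)`. -/
def toRep (ρ : A →* (V ≃ₗᵢ[ℂ] V)) : Representation ℂ A V where
  toFun a := (ρ a).toLinearEquiv.toLinearMap
  map_one' := by rw [map_one]; rfl
  map_mul' a b := by rw [map_mul]; rfl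

@[simp] theorem toRep_apply (ρ : A →* (V ≃ₗᵢ[ℂ] V)) (a : A) (x : V) : toRep ρ a x = ρ a x := rfl

/-- The evaluation map `V ⊗ Hom_A(V, F) → F`. -/
def evalMap {B F : Type*} [Group B] [AddCommGroup F] [Module ℂ F] (τ : Representation ℂ B V)
    (σ : Representation ℂ B F) : V ⊗[ℂ] Representation.IntertwiningMap τ σ →ₗ[ℂ] F :=
  TensorProduct.lift (LinearMap.flip
    { toFun := fun f => f.toLinearMap
      map_add' := fun _ _ => rfl
      map_smul' := fun _ _ => rfl })

@[simp] theorem evalMap_tmul {B F : Type*} [Group B] [AddCommGroup F] [Module ℂ F]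
    (τ : Representation ℂ B V) (σ : Representation ℂ B F) (x : V)
    (f : Representation.IntertwiningMap τ σ) : evalMap τ σ (x ⊗ₜ[ℂ] f) = f x := rfl

/-- Composition with an equivariant map. -/
def postComp {B F F' : Type*} [Group B] [AddCommGroup F] [Module ℂ F] [AddCommGroup F']
    [Module ℂ F'] (τ : Representation ℂ B V) {σ : Representation ℂ B F}
    {σ' : Representation ℂ B F'} (g : F →ₗ[ℂ] F') (hg : ∀ b x, g (σ b x) = σ' b (g x)) :
    Representation.IntertwiningMap τ σ →ₗ[ℂ] Representation.IntertwiningMap τ σ' where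
  toFun f := ⟨g ∘ₗ f.toLinearMap, fun b => by
    ext x
    have := Representation.IntertwiningMap.isIntertwining τ σ f b x
    simp [this, hg]⟩
  map_add' f f' := by ext; simp
  map_smul' c f := by ext; simp

theorem evalMap_postComp {B F F' : Type*} [Group B] [AddCommGroup F] [Module ℂ F]
    [AddCommGroup F'] [Module ℂ F'] (τ : Representation ℂ B V) {σ : Representation ℂ B F}
    {σ' : Representation ℂ B F'} (g : F →ₗ[ℂ] F') (hg : ∀ b x, g (σ b x) = σ' b (g x))
    (t : V ⊗[ℂ] Representation.IntertwiningMap τ σ) :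
    evalMap τ σ' (LinearMap.lTensor V (postComp τ g hg) t) = g (evalMap τ σ t) := by
  refine tmul_equiv_of_tmul (f := evalMap τ σ' ∘ₗ LinearMap.lTensor V (postComp τ g hg))
    (g := g ∘ₗ evalMap τ σ) (fun a b => ?_) t
  rfl

/-- A representation which is a retract of a finite family of representations on which the
evaluation map is bijective has this property. -/
theorem bijective_evalMap {B F κ : Type*} [Group B] [AddCommGroup F] [Module ℂ F] [Fintype κ]
    {F' : κ → Type*} [∀ k, AddCommGroup (F' k)] [∀ k, Module ℂ (F' k)]
    (τ : Representation ℂ B V) {σ : Representation ℂ B F}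
    {σ' : ∀ k, Representation ℂ B (F' k)} (π : ∀ k, F →ₗ[ℂ] F' k) (ι : ∀ k, F' k →ₗ[ℂ] F)
    (hπ : ∀ k b x, π k (σ b x) = σ' k b (π k x)) (hι : ∀ k b x, ι k (σ' k b x) = σ b (ι k x))
    (hs : ∀ x, ∑ k, ι k (π k x) = x) (h : ∀ k, Function.Bijective (evalMap τ (σ' k))) :
    Function.Bijective (evalMap τ σ) := by
  refine ⟨(injective_iff_map_eq_zero _).2 fun t ht => ?_, fun x => ?_⟩
  · have h₁ : ∀ k, LinearMap.lTensor V (postComp τ (π k) (hπ k)) t = 0 := fun k => by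
      apply (h k).1
      rw [evalMap_postComp, ht, map_zero, map_zero]
    have h₂ : ∑ k, LinearMap.lTensor V (postComp τ (ι k) (hι k))
        (LinearMap.lTensor V (postComp τ (π k) (hπ k)) t) = t := by
      have := tmul_equiv_of_tmul (g := LinearMap.id)
        (f := ∑ k, LinearMap.lTensor V (postComp τ (ι k) (hι k)) ∘ₗ
          LinearMap.lTensor V (postComp τ (π k) (hπ k))) (fun a b => by
            simp only [LinearMap.sum_apply, LinearMap.comp_apply, LinearMap.lTensor_tmul,
              ← TensorProduct.tmul_sum, LinearMap.id_apply]
            congr 1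
            ext x
            rw [Representation.IntertwiningMap.toLinearMap_sum, LinearMap.sum_apply]
            exact hs (b x)) t
      simpa using this
    rw [← h₂]
    simp [h₁]
  · choose t ht using fun k => (h k).2 (π k x)
    refine ⟨∑ k, LinearMap.lTensor V (postComp τ (ι k) (hι k)) (t k), ?_⟩
    rw [map_sum]
    simp only [evalMap_postComp, ht, hs]

/-- `A` as the kernel of `G → G / A`. -/
def toKer (A : Subgroup G) [A.Normal] : A →* (QuotientGroup.mk' A).ker :=
  Subgroup.inclusion (by rw [QuotientGroup.ker_mk'])

/-- `(G, ρ)`-equivariant bundles over `G`-spaces on which `A` acts trivially: `G`-equivariant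
vector bundles `E` for which the evaluation map `V ⊗ Hom_A(V, E) → E` is an isomorphism (on each
fibre). -/
def rhoKind [A.Normal] (ρ : A →* (V ≃ₗᵢ[ℂ] V)) : Kind.{v, w, w} (G ⧸ A) where
  grp := G
  top := ⊥
  proj := QuotientGroup.mk' A
  locConst := by
    let _ : TopologicalSpace G := ⊥
    have : DiscreteTopology G := ⟨rfl⟩
    exact IsLocallyConstant.of_discrete _
  cond F _ _ σ := Function.Bijective (evalMap (toRep ρ) (σ.comp (toKer A)))
  cond_zero σ := bijective_evalMap (κ := Empty) (F' := fun _ => PUnit.{v + 1}) _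
    (σ' := fun _ => 1) (fun _ => 0) (fun _ => 0)
    (fun k => k.elim) (fun k => k.elim) (fun _ => rfl) (fun k => k.elim)
  cond_sum F F' _ _ _ _ σ σ' h h' := by
    let T : Bool → Type v := fun k => match k with | true => F | false => F'
    let _ : ∀ k, AddCommGroup (T k) := fun k => match k with
      | true => inferInstanceAs (AddCommGroup F)
      | false => inferInstanceAs (AddCommGroup F')
    let _ : ∀ k, Module ℂ (T k) := fun k => match k with
      | true => inferInstanceAs (Module ℂ F)
      | false => inferInstanceAs (Module ℂ F')
    refine bijective_evalMap (F' := T) _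
      (σ' := fun k => match k with | true => σ.comp (toKer A) | false => σ'.comp (toKer A))
      (fun k => match k with | true => LinearMap.fst ℂ F F' | false => LinearMap.snd ℂ F F')
      (fun k => match k with | true => LinearMap.inl ℂ F F' | false => LinearMap.inr ℂ F F')
      (fun k => match k with | true => fun _ _ => rfl | false => fun _ _ => rfl)
      (fun k => match k with
        | true => fun a x => Prod.ext rfl (map_zero (σ' (toKer A a))).symm
        | false => fun a x => Prod.ext (map_zero (σ (toKer A a))).symm rfl)
      (fun x => ?_) (fun k => match k with | true => h | false => h')
    rw [Fintype.sum_bool]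
    exact Prod.ext (add_zero _) (zero_add _)
  cond_tensor W F _ _ _ _ _ σ h := by
    let b := Module.finBasis ℂ W
    refine bijective_evalMap (F' := fun _ => F) (σ' := fun _ => σ.comp (toKer A)) _
      (fun k => Family.contract (b.coord k)) (fun k => TensorProduct.mk ℂ W F (b k))
      (fun k a x => ?_) (fun k a x => rfl) (Family.sum_contract b) (fun _ => h)
    exact tmul_equiv_of_tmul (f := Family.contract (b.coord k) ∘ₗ
        TensorProduct.map 1 (σ (toKer A a)))
      (g := σ (toKer A a) ∘ₗ Family.contract (b.coord k)) (fun a b => by simp) x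

end Isotypic

section Lifts

variable {G : Type w} [Group G] {A : Subgroup G} [A.Normal]
variable {V : Type v} [NormedAddCommGroup V] [InnerProductSpace ℂ V]

/-- The representation `g · ρ`, given by `(g · ρ)(a) = ρ(g⁻¹ a g)`. -/
def conjRep (g : G) (ρ : A →* (V ≃ₗᵢ[ℂ] V)) : A →* (V ≃ₗᵢ[ℂ] V) :=
  ρ.comp (MulAut.conjNormal g⁻¹).toMonoidHom

/-- The choices made for a unitary representation `ρ` of `A`: a set-theoretic section `σ` of
`G → Q = G / A` with `σ(1) = 1`, and elements `M_q ∈ U(V)` with `M_1 = 1` and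
`ρ(σ(q)⁻¹ a σ(q)) = M_q⁻¹ ρ(a) M_q`. -/
structure Lifts (ρ : A →* (V ≃ₗᵢ[ℂ] V)) where
  σ : G ⧸ A → G
  mk_σ : ∀ q, (QuotientGroup.mk (σ q) : G ⧸ A) = q
  σ_one : σ 1 = 1
  M : G ⧸ A → (V ≃ₗᵢ[ℂ] V)
  M_one : M 1 = 1
  conj : ∀ q a, conjRep (σ q) ρ a = (M q)⁻¹ * ρ a * M q

variable {ρ : A →* (V ≃ₗᵢ[ℂ] V)} (D : Lifts ρ)

namespace Lifts

/-- `χ(q₁, q₂) = σ(q₁ q₂)⁻¹ σ(q₁) σ(q₂) ∈ A`. -/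
def χ (q₁ q₂ : G ⧸ A) : A :=
  ⟨(D.σ (q₁ * q₂))⁻¹ * (D.σ q₁ * D.σ q₂), by
    rw [← QuotientGroup.eq, QuotientGroup.mk_mul, D.mk_σ, D.mk_σ, D.mk_σ]⟩

theorem χ_spec (q₁ q₂ : G ⧸ A) : D.σ q₁ * D.σ q₂ = D.σ (q₁ * q₂) * (D.χ q₁ q₂ : G) := by
  simp [χ]

/-- The unitary transformation `ρ(χ(q₁, q₂)) M_{q₂}⁻¹ M_{q₁}⁻¹ M_{q₁ q₂}`. -/
def obstruction (q₁ q₂ : G ⧸ A) : V ≃ₗᵢ[ℂ] V :=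
  ρ (D.χ q₁ q₂) * (D.M q₂)⁻¹ * (D.M q₁)⁻¹ * D.M (q₁ * q₂)

theorem conj' (q : G ⧸ A) (a : A) :
    ρ a * D.M q = D.M q * ρ (MulAut.conjNormal (D.σ q)⁻¹ a) := by
  have := D.conj q a
  change ρ (MulAut.conjNormal (D.σ q)⁻¹ a) = _ at this
  rw [this]; group

theorem conj'' (q : G ⧸ A) (a : A) :
    (D.M q)⁻¹ * ρ a = ρ (MulAut.conjNormal (D.σ q)⁻¹ a) * (D.M q)⁻¹ := by
  have := D.conj q a
  change ρ (MulAut.conjNormal (D.σ q)⁻¹ a) = _ at this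
  rw [this]; group

theorem obstruction_comm (q₁ q₂ : G ⧸ A) (a : A) :
    D.obstruction q₁ q₂ * ρ a = ρ a * D.obstruction q₁ q₂ := by
  have h₁ : ∀ q a, D.M q * ρ a = ρ (MulAut.conjNormal (D.σ q) a) * D.M q := fun q a => by
    rw [D.conj']
    congr 2
    simp
  simp only [obstruction]
  rw [mul_assoc _ (D.M (q₁ * q₂)), h₁, ← mul_assoc, mul_assoc _ (D.M q₁)⁻¹, conj'', ← mul_assoc,
    mul_assoc _ (D.M q₂)⁻¹, conj'', ← mul_assoc, ← map_mul]
  simp only [← mul_assoc, ← map_mul]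
  have h₂ : D.χ q₁ q₂ * MulAut.conjNormal (D.σ q₂)⁻¹ (MulAut.conjNormal (D.σ q₁)⁻¹
      (MulAut.conjNormal (D.σ (q₁ * q₂)) a)) = a * D.χ q₁ q₂ := by
    ext
    simp [χ, mul_assoc]
  rw [h₂]

theorem nontrivial [Representation.IsIrreducible (toRep ρ)] : Nontrivial V := by
  by_contra h
  rw [not_nontrivial_iff_subsingleton] at h
  refine bot_ne_top (α := Subrepresentation (toRep ρ)) (SetLike.ext fun x => ?_)
  rw [Subsingleton.elim x 0]
  exact ⟨fun _ => Submodule.zero_mem (⊤ : Subrepresentation (toRep ρ)).toSubmodule,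
    fun _ => Submodule.zero_mem (⊥ : Subrepresentation (toRep ρ)).toSubmodule⟩

variable [FiniteDimensional ℂ V] [Representation.IsIrreducible (toRep ρ)]

/-- By Schur's lemma the obstruction is a scalar of absolute value one. -/
theorem exists_scalar (q₁ q₂ : G ⧸ A) :
    ∃ z : Circle, ∀ x : V, D.obstruction q₁ q₂ x = (z : ℂ) • x := by
  let f : Representation.IntertwiningMap (toRep ρ) (toRep ρ) :=
    ⟨(D.obstruction q₁ q₂).toLinearEquiv.toLinearMap, fun a => by
      ext x
      exact DFunLike.congr_fun (D.obstruction_comm q₁ q₂ a) x⟩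
  obtain ⟨c, hc⟩ :=
    (Representation.IsIrreducible.algebraMap_intertwiningMap_bijective_of_isAlgClosed
      (ρ := toRep ρ)).2 f
  have h : ∀ x : V, D.obstruction q₁ q₂ x = c • x := fun x => by
    have := DFunLike.congr_fun hc x
    rw [Algebra.algebraMap_eq_smul_one] at this
    exact this.symm
  have := nontrivial (ρ := ρ)
  obtain ⟨x, hx⟩ := exists_ne (0 : V)
  refine ⟨⟨c, ?_⟩, h⟩
  have h₁ := (D.obstruction q₁ q₂).norm_map x
  rw [h, norm_smul] at h₁
  simpa [Submonoid.unitSphere] using (mul_eq_right₀ (norm_ne_zero_iff.2 hx)).1 h₁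

/-- The function `α_ρ`: the scalar `ρ(χ(q₁, q₂)) M_{q₂}⁻¹ M_{q₁}⁻¹ M_{q₁ q₂} ∈ Z(U(V)) = S¹`. -/
def αfun (q₁ q₂ : G ⧸ A) : Circle := Classical.choose (D.exists_scalar q₁ q₂)

theorem αfun_spec (q₁ q₂ : G ⧸ A) (x : V) : D.obstruction q₁ q₂ x = (D.αfun q₁ q₂ : ℂ) • x :=
  Classical.choose_spec (D.exists_scalar q₁ q₂) x

theorem αfun_eq (q₁ q₂ : G ⧸ A) {z : Circle} {x : V} (hx : x ≠ 0)
    (h : D.obstruction q₁ q₂ x = (z : ℂ) • x) : D.αfun q₁ q₂ = z := by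
  rw [αfun_spec] at h
  exact Circle.ext (smul_left_injective ℂ hx h)

theorem αfun_spec' (q₁ q₂ : G ⧸ A) (x : V) :
    ρ (D.χ q₁ q₂) ((D.M q₂)⁻¹ ((D.M q₁)⁻¹ x)) = (D.αfun q₁ q₂ : ℂ) • (D.M (q₁ * q₂))⁻¹ x := by
  rw [← αfun_spec]
  simp [obstruction]

theorem αfun_spec'' (q₁ q₂ : G ⧸ A) (x : V) :
    (D.αfun q₁ q₂ : ℂ) • D.M q₁ (D.M q₂ x) = D.M (q₁ * q₂) (ρ (D.χ q₁ q₂) x) := by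
  have h := D.αfun_spec' q₁ q₂ (D.M q₁ (D.M q₂ x))
  have h' := congrArg (D.M (q₁ * q₂)) h
  rw [map_smul] at h'
  simpa using h'.symm

/-- The normalized 2-cocycle `α_ρ`. -/
def α : NormCocycle (G ⧸ A) where
  toFun := D.αfun
  cocycle q₁ q₂ q₃ := by
    have := nontrivial (ρ := ρ)
    obtain ⟨x, hx⟩ := exists_ne (0 : V)
    have h₁ : ((D.αfun q₁ (q₂ * q₃) * D.αfun q₂ q₃ : Circle) : ℂ) • D.M q₁ (D.M q₂ (D.M q₃ x))
        = D.M (q₁ * (q₂ * q₃)) (ρ (D.χ q₁ (q₂ * q₃) * D.χ q₂ q₃) x) := by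
      rw [Circle.coe_mul, mul_smul, ← map_smul, αfun_spec'', αfun_spec'', map_mul]; rfl
    have h₂ : ((D.αfun (q₁ * q₂) q₃ * D.αfun q₁ q₂ : Circle) : ℂ) • D.M q₁ (D.M q₂ (D.M q₃ x))
        = D.M (q₁ * q₂ * q₃) (ρ (D.χ (q₁ * q₂) q₃ *
          MulAut.conjNormal (D.σ q₃)⁻¹ (D.χ q₁ q₂)) x) := by
      have h := DFunLike.congr_fun (D.conj' q₃ (D.χ q₁ q₂)) x
      change ρ (D.χ q₁ q₂) (D.M q₃ x) = D.M q₃ _ at h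
      rw [Circle.coe_mul, mul_smul, αfun_spec'', h, αfun_spec'', map_mul]; rfl
    have h₃ : D.χ q₁ (q₂ * q₃) * D.χ q₂ q₃
        = D.χ (q₁ * q₂) q₃ * MulAut.conjNormal (D.σ q₃)⁻¹ (D.χ q₁ q₂) := by
      ext
      simp [χ, mul_assoc]
    rw [h₃, ← mul_assoc q₁, ← h₂] at h₁
    exact Circle.ext (smul_left_injective ℂ (m := D.M q₁ (D.M q₂ (D.M q₃ x)))
      (by simpa using hx) h₁)
  one_left q := by
    have := nontrivial (ρ := ρ)
    obtain ⟨x, hx⟩ := exists_ne (0 : V)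
    refine D.αfun_eq 1 q hx ?_
    have : D.χ 1 q = 1 := by ext; simp [χ, D.σ_one]
    simp [obstruction, this, D.M_one]
  one_right q := by
    have := nontrivial (ρ := ρ)
    obtain ⟨x, hx⟩ := exists_ne (0 : V)
    refine D.αfun_eq q 1 hx ?_
    have : D.χ q 1 = 1 := by ext; simp [χ, D.σ_one]
    simp [obstruction, this, D.M_one]

end Lifts

section HomFamily

variable [FiniteDimensional ℂ V] [Representation.IsIrreducible (toRep ρ)]
variable {X : Type u} [TopologicalSpace X] [MulAction (G ⧸ A) X]

/-- The representation of `A` on a fibre of a `G`-equivariant family over a `G`-space on which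
`A` acts trivially. -/
def fibRep (E : Family.{u, v} (QuotientGroup.mk' A) X) (x : X) :
    Representation ℂ A (E.fiber x) :=
  (E.kerRep x).comp (toKer A)

theorem fibRep_apply (E : Family.{u, v} (QuotientGroup.mk' A) X) (x : X) (a : A)
    (h : QuotientGroup.mk' A (a : G) • x = x) (e : E.fiber x) : fibRep E x a e = E.act a h e := rfl

theorem act_congr (E : Family.{u, v} (QuotientGroup.mk' A) X) {g h : G} (hgh : g = h) {x y : X}
    (h₁ : QuotientGroup.mk' A g • x = y) (h₂ : QuotientGroup.mk' A h • x = y) (e : E.fiber x) :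
    E.act g h₁ e = E.act h h₂ e := by
  subst hgh; rfl

theorem fib_act (E : Family.{u, v} (QuotientGroup.mk' A) X) {x y : X} (g h : G) (a b : A)
    (hgh : g * a = b * h) (h₁ : QuotientGroup.mk' A g • x = y)
    (h₂ : QuotientGroup.mk' A h • x = y) (e : E.fiber x) :
    E.act g h₁ (fibRep E x a e) = fibRep E y b (E.act h h₂ e) := by
  have ha : QuotientGroup.mk' A (a : G) • x = x := by
    rw [show QuotientGroup.mk' A (a : G) = 1 from (QuotientGroup.eq_one_iff _).2 a.2, one_smul]
  have hb : QuotientGroup.mk' A (b : G) • y = y := by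
    rw [show QuotientGroup.mk' A (b : G) = 1 from (QuotientGroup.eq_one_iff _).2 b.2, one_smul]
  have h₃ : QuotientGroup.mk' A (g * a) • x = y := by rw [map_mul, mul_smul, ha, h₁]
  have h₄ : QuotientGroup.mk' A (b * h) • x = y := by rw [map_mul, mul_smul, h₂, hb]
  rw [fibRep_apply E x a ha, fibRep_apply E y b hb, ← E.act_mul g a ha h₁ h₃,
    ← E.act_mul b h h₂ hb h₄]
  exact act_congr E hgh _ _ _

/-- The family `Hom_A(V, E)`, with the action `((q, z) · f)(x) = z σ(q) f(M_q⁻¹ x)` of the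
extension defined by `α_ρ`.  The total space carries the topology of pointwise convergence, i.e.
the coarsest topology for which the projection to `X` and the evaluations `f ↦ f(x)` at the
vectors `x ∈ V` are continuous. -/
def homFamily (E : Family.{u, v} (QuotientGroup.mk' A) X) : Family.{u, v} (TwExt.proj D.α) X where
  fiber x := Representation.IntertwiningMap (toRep ρ) (fibRep E x)
  top := TopologicalSpace.induced
    (fun t => (t.1, fun x : V => E.pt t.1 (t.2 x))) inferInstance
  act γ {x y} h :=
    { toFun := fun f =>
        ⟨(γ.z : ℂ) • (E.act (D.σ γ.q) (by rw [← h]; exact congrArg (· • x) (D.mk_σ γ.q)) ∘ₗ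
          f.toLinearMap ∘ₗ (D.M γ.q)⁻¹.toLinearEquiv.toLinearMap), fun a => by
            ext x
            have h₁ := DFunLike.congr_fun (D.conj'' γ.q a) x
            have h₂ := Representation.IntertwiningMap.isIntertwining _ _ f
              (MulAut.conjNormal (D.σ γ.q)⁻¹ a) ((D.M γ.q)⁻¹ x)
            change (γ.z : ℂ) • E.act _ _ (f ((D.M γ.q)⁻¹ (ρ a x)))
              = fibRep E y a ((γ.z : ℂ) • E.act _ _ (f ((D.M γ.q)⁻¹ x)))
            rw [map_smul]
            refine congrArg _ ?_
            change (D.M γ.q)⁻¹ (ρ a x) = ρ _ ((D.M γ.q)⁻¹ x) at h₁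
            rw [h₁]
            refine (congrArg _ h₂).trans ?_
            exact fib_act E _ _ _ _ (by simp [mul_assoc]) _ _ _⟩
      map_add' := fun f f' => by ext; simp
      map_smul' := fun c f => by
        ext x
        change (γ.z : ℂ) • E.act _ _ (c • f ((D.M γ.q)⁻¹ x))
          = c • (γ.z : ℂ) • E.act _ _ (f ((D.M γ.q)⁻¹ x))
        rw [map_smul, smul_comm] }
  act_one {x} h f := by
    ext v
    change ((1 : Circle) : ℂ) • E.act (D.σ 1) _ (f ((D.M 1)⁻¹ v)) = f v
    have hx : QuotientGroup.mk' A (1 : G) • x = x := by rw [map_one, one_smul]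
    rw [D.M_one, Circle.coe_one, one_smul, act_congr E D.σ_one _ hx, E.act_one]
    simp
  act_mul γ δ x y z h₁ h₂ h₃ f := by
    ext v
    have hσ : ∀ {q : G ⧸ A} {x y : X}, q • x = y → QuotientGroup.mk' A (D.σ q) • x = y :=
      fun {q x y} h => by rw [← h]; exact congrArg (· • x) (D.mk_σ q)
    have e₁ : QuotientGroup.mk' A (D.σ δ.q) • x = y := hσ h₁
    have e₂ : QuotientGroup.mk' A (D.σ γ.q) • y = z := hσ h₂
    have e₃ : QuotientGroup.mk' A (D.σ (γ.q * δ.q)) • x = z := hσ h₃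
    have e₄ : QuotientGroup.mk' A (D.σ γ.q * D.σ δ.q) • x = z := by
      rw [map_mul, mul_smul, e₁, e₂]
    change ((D.αfun γ.q δ.q * γ.z * δ.z : Circle) : ℂ) •
        E.act (D.σ (γ.q * δ.q)) e₃ (f ((D.M (γ.q * δ.q))⁻¹ v))
      = (γ.z : ℂ) • E.act (D.σ γ.q) e₂ ((δ.z : ℂ) • E.act (D.σ δ.q) e₁
        (f ((D.M δ.q)⁻¹ ((D.M γ.q)⁻¹ v))))
    rw [map_smul, ← E.act_mul _ _ e₁ e₂ e₄]
    have ha : QuotientGroup.mk' A (D.χ γ.q δ.q : G) • x = x := by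
      rw [show QuotientGroup.mk' A (D.χ γ.q δ.q : G) = 1 from
        (QuotientGroup.eq_one_iff _).2 (D.χ γ.q δ.q).2, one_smul]
    have e₅ : QuotientGroup.mk' A (D.σ (γ.q * δ.q) * (D.χ γ.q δ.q : G)) • x = z := by
      rw [map_mul, mul_smul, ha, e₃]
    rw [act_congr E (D.χ_spec γ.q δ.q) e₄ e₅, E.act_mul _ _ ha e₃ e₅]
    have h := Representation.IntertwiningMap.isIntertwining _ _ f (D.χ γ.q δ.q)
      ((D.M δ.q)⁻¹ ((D.M γ.q)⁻¹ v))
    change f (ρ _ _) = E.act _ ha _ at h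
    rw [← h, D.αfun_spec', map_smul, map_smul, Circle.coe_mul, Circle.coe_mul]
    simp only [smul_smul]
    congr 1
    ring

end HomFamily

end Lifts

section QuotientAction

variable {G : Type w} [Group G] (A : Subgroup G)

/-- The subgroup `A` acts trivially on the `G`-space `X`. -/
class ActsTrivially (X : Type u) [MulAction G X] : Prop where
  smul_eq : ∀ a ∈ A, ∀ x : X, a • x = x

variable [A.Normal] (X : Type u) [MulAction G X] [ActsTrivially A X]

/-- The induced action of `Q = G / A` on a `G`-space on which `A` acts trivially. -/
instance quotientAction : MulAction (G ⧸ A) X where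
  smul q x := Quotient.liftOn' q (fun g => g • x) fun g h hgh => by
    have := ActsTrivially.smul_eq _ (QuotientGroup.leftRel_apply.1 hgh) x
    rw [mul_smul, inv_smul_eq_iff] at this
    exact this.symm
  one_smul x := one_smul G x
  mul_smul q r x := by
    induction q using QuotientGroup.induction_on
    induction r using QuotientGroup.induction_on
    exact mul_smul (α := G) _ _ x

theorem mk_smul (g : G) (x : X) : (QuotientGroup.mk g : G ⧸ A) • x = g • x := rfl

instance [TopologicalSpace X] [ContinuousConstSMul G X] : ContinuousConstSMul (G ⧸ A) X where
  continuous_const_smul q := by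
    induction q using QuotientGroup.induction_on with
    | H g => exact continuous_const_smul g

variable {X} {Y : Type u} [MulAction G Y] [ActsTrivially A Y] [TopologicalSpace X]
  [TopologicalSpace Y]

/-- A continuous `G`-equivariant map as an equivariant map of `Q`-spaces. -/
def EqMap.ofG (f : X → Y) (hf : Continuous f) (hG : ∀ (g : G) (x : X), f (g • x) = g • f x) :
    EqMap (G ⧸ A) X Y where
  toFun := f
  continuous := hf
  map_smul q x := by
    induction q using QuotientGroup.induction_on with
    | H g => exact hG g x

end QuotientAction

end EqK

end

/-! The theorem is a Morita equivalence in families. Over a point, the representations of `A` for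
which evaluation `V ⊗ Hom_A(V, F) → F` is bijective are those of the form `V ⊗ N`, and Schur's lemma
recovers `N` as `Hom_A(V, V ⊗ N)`. The functors `Hom_A(V, -)` and `V ⊗ -` are therefore inverse to
each other on fibres; what has to be followed is the action of `G` and the topology.

For the action, `ρ` extends to a projective representation `P` of `G`, `P(σ(q) a) = M_q ρ(a)`, and
`P(gh) = α(ḡ, h̄) P(g) P(h)` (`projRep_mul`). On a twisted bundle the elements `(q, 1)` of the
extension satisfy `(q, 1)(r, 1) = (qr, α(q, r))`, so `α` appears there on the other side. In `g ↦
P(g) ⊗ (ḡ, 1)` the two multipliers cancel, and `V ⊗ F` carries a genuine action of `G`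
(`tensorFamily`). Evaluation (`homEval_act`) and coevaluation (`coev_act`) are equivariant because
`M_q⁻¹` in the action on `Hom_A(V, E)` cancels `M_q` in `P`.

For the topology, the essential point is that `Hom_A(V, E)` is locally trivial. Averaging over the
finite group `A` turns a chart of `E` into one in which `A` acts by a constant representation `R`
(`exists_equivariant_chart`), and then `Hom_A(V, E)` is locally the constant bundle with fibre
`Hom_A(V, R)`. After that, every isomorphism of bundles needs continuity in one direction only
(`iso_of_continuous`).

The result is a bijection of isomorphism classes. Additivity, `R(Q)`-linearity and naturality are
checked for `V ⊗ -`, where they are canonical isomorphisms of tensor products, and pass to the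
inverse. Grothendieck groups then give `K⁰`; naturality for the inclusion of the base point gives
the restriction to kernels, that is `Kⁿ`.

The choices `(σ, M)` exist because an invertible intertwiner between unitary representations, one of
them irreducible, becomes unitary after rescaling (`exists_unitary_of_equiv`). -/

noncomputable section

namespace EqK

open Topology TensorProduct

/-! ### Schur's lemma and the existence of the choices `(σ, M)`. -/

section Unitary

variable {G : Type w} [Group G] {A : Subgroup G} [A.Normal]
variable {V : Type v} [NormedAddCommGroup V] [InnerProductSpace ℂ V]
variable {ρ : A →* (V ≃ₗᵢ[ℂ] V)} [Representation.IsIrreducible (toRep ρ)]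

/-- Schur's lemma for an irreducible unitary representation. -/
theorem exists_eq_smul_of_commute [FiniteDimensional ℂ V] (f : V →ₗ[ℂ] V)
    (hf : ∀ a x, f (ρ a x) = ρ a (f x)) : ∃ c : ℂ, ∀ x, f x = c • x := by
  let F : Representation.IntertwiningMap (toRep ρ) (toRep ρ) :=
    ⟨f, fun a => LinearMap.ext (hf a)⟩
  obtain ⟨c, hc⟩ :=
    (Representation.IsIrreducible.algebraMap_intertwiningMap_bijective_of_isAlgClosed
      (ρ := toRep ρ)).2 F
  refine ⟨c, fun x => ?_⟩
  have := DFunLike.congr_fun hc x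
  rw [Algebra.algebraMap_eq_smul_one] at this
  exact this.symm

/-- A unitary representation which is isomorphic to an irreducible unitary representation is
unitarily isomorphic to it. -/
theorem exists_unitary_of_equiv [FiniteDimensional ℂ V] (ρ' : A →* (V ≃ₗᵢ[ℂ] V))
    (e : Representation.Equiv (toRep ρ') (toRep ρ)) :
    ∃ M : V ≃ₗᵢ[ℂ] V, ∀ a, ρ' a = M⁻¹ * ρ a * M := by
  have : Nontrivial V := Lifts.nontrivial (ρ := ρ)
  have he : ∀ a x, e (ρ' a x) = ρ a (e x) := fun a x =>
    Representation.IntertwiningMap.isIntertwining _ _ e.toIntertwiningMap a x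
  have hsurj : Function.Surjective e := e.toLinearEquiv.surjective
  let e' : V →ₗ[ℂ] V := LinearMap.adjoint e.toLinearEquiv.toLinearMap
  have hadj : ∀ x y, inner ℂ (e' x) y = inner ℂ x (e y) := fun x y =>
    LinearMap.adjoint_inner_left _ _ _
  have hunit : ∀ (τ : A →* (V ≃ₗᵢ[ℂ] V)) (a : A) (x y : V),
      inner ℂ (τ a x) y = inner ℂ x (τ a⁻¹ y) := fun τ a x y => by
    rw [← (τ a⁻¹).inner_map_map (τ a x) y, map_inv]
    simp
  have he' : ∀ a x, e' (ρ a x) = ρ' a (e' x) := fun a x => by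
    refine ext_inner_right ℂ fun y => ?_
    rw [hadj, hunit, ← he, hunit, hadj]
  -- The adjoint of an intertwiner of unitary representations is an intertwiner in the other
  -- direction, so `e e*` commutes with `ρ` and is a scalar. The order `e e*` is chosen because
  -- irreducibility is given for `ρ`, not for `ρ'`.
  obtain ⟨c, hc⟩ := exists_eq_smul_of_commute (ρ := ρ) (e.toLinearEquiv.toLinearMap ∘ₗ e')
    fun a x => by
      change e (e' (ρ a x)) = ρ a (e (e' x))
      rw [he', he]
  replace hc : ∀ x, e (e' x) = c • x := hc
  -- `‖e* x‖² = ⟨x, e e* x⟩ = c ‖x‖²`; taking real parts avoids a separate proof that `c` is real.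
  have hn : ∀ x, ‖e' x‖ ^ 2 = c.re * ‖x‖ ^ 2 := fun x => by
    have h : inner ℂ (e' x) (e' x) = c * inner ℂ x x := by
      rw [hadj, hc, inner_smul_right]
    rw [inner_self_eq_norm_sq_to_K, inner_self_eq_norm_sq_to_K] at h
    have h' : ((‖e' x‖ ^ 2 : ℝ) : ℂ) = c * ((‖x‖ ^ 2 : ℝ) : ℂ) := by
      push_cast
      exact h
    simpa only [Complex.ofReal_re, Complex.re_mul_ofReal] using congrArg Complex.re h'
  obtain ⟨x₀, hx₀⟩ := exists_ne (0 : V)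
  -- `e*` is injective because `e` is onto: a vector killed by `e*` is orthogonal to the range of
  -- `e`, hence to itself.
  have hx₁ : e' x₀ ≠ 0 := fun h => by
    obtain ⟨y, hy⟩ := hsurj x₀
    have := hadj x₀ y
    rw [h, inner_zero_left, hy] at this
    exact hx₀ (inner_self_eq_zero.1 this.symm)
  have hr : 0 < c.re := by
    have h₁ := hn x₀
    have h₂ : 0 < ‖e' x₀‖ ^ 2 := by positivity
    have h₃ : 0 < ‖x₀‖ ^ 2 := by positivity
    rw [h₁] at h₂
    exact (pos_iff_pos_of_mul_pos h₂).2 h₃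
  -- By `hn`, dividing `e*` by the square root of `c.re` makes it isometric, hence unitary in finite
  -- dimension. It intertwines `ρ` with `ρ'`, so the required `M` is its inverse.
  let N : V →ₗᵢ[ℂ] V :=
    { toLinearMap := ((Real.sqrt c.re)⁻¹ : ℂ) • e'
      norm_map' := fun x => by
        rw [LinearMap.smul_apply, norm_smul, norm_inv, Complex.norm_real, Real.norm_eq_abs,
          abs_of_nonneg (Real.sqrt_nonneg _), inv_mul_eq_iff_eq_mul₀ (by positivity)]
        refine (sq_eq_sq₀ (norm_nonneg _) (by positivity)).1 ?_
        rw [hn, mul_pow, Real.sq_sqrt hr.le] }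
  let N' : V ≃ₗᵢ[ℂ] V := N.toLinearIsometryEquiv rfl
  have hN : ∀ a, ρ' a * N' = N' * ρ a := fun a => by
    ext x
    change ρ' a (((Real.sqrt c.re)⁻¹ : ℂ) • e' x) = ((Real.sqrt c.re)⁻¹ : ℂ) • e' (ρ a x)
    rw [map_smul, he']
  refine ⟨N'⁻¹, fun a => ?_⟩
  rw [inv_inv, ← hN, mul_inv_cancel_right]

/-- An invariant irreducible representation admits the choices of `Lifts`. -/
theorem nonempty_lifts [FiniteDimensional ℂ V]
    (hinv : ∀ g : G, Nonempty (Representation.Equiv (toRep (conjRep g ρ)) (toRep ρ))) :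
    Nonempty (Lifts ρ) := by
  classical
  choose M hM using fun g => exists_unitary_of_equiv (conjRep g ρ) (hinv g).some
  refine ⟨
    -- Arbitrary choices need not be normalised, so the values at the trivial class are replaced by
    -- `1`; there the conjugation identity is trivial.
    { σ := fun q => if q = 1 then 1 else q.out
      mk_σ := fun q => ?_
      σ_one := if_pos rfl
      M := fun q => if q = 1 then 1 else M q.out
      M_one := if_pos rfl
      conj := fun q a => ?_ }⟩
  · split_ifs with h
    · rw [h]; rfl
    · exact QuotientGroup.out_eq' q
  · split_ifs with h
    · have : (MulAut.conjNormal (1 : G)⁻¹ a : A) = a := by ext; simp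
      change ρ (MulAut.conjNormal (1 : G)⁻¹ a) = _
      rw [this]; simp
    · exact hM _ a

end Unitary

/-! ### Continuity of fibrewise linear operations on sections of a bundle. -/

namespace Family

section Continuity

variable {Γ : Type w'} [Group Γ] {Q : Type w} [Group Q] {p : Γ →* Q} {X : Type u}
  [MulAction Q X] [TopologicalSpace Γ] [TopologicalSpace X]

/-- Linear combinations of sections of a vector bundle with continuous coefficients are
continuous. -/
theorem IsVectorBundle.continuous_sum_smul {E : Family.{u, v} p X} (hE : E.IsVectorBundle)
    {T κ : Type*} [TopologicalSpace T] [Fintype κ] {x : T → X} (hx : Continuous x)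
    {c : κ → T → ℂ} (hc : ∀ k, Continuous (c k)) {s : κ → ∀ t, E.fiber (x t)}
    (hs : ∀ k, Continuous fun t => E.pt (x t) (s k t)) :
    Continuous fun t => E.pt (x t) (∑ k, c k t • s k t) := by
  refine continuous_iff_continuousAt.2 fun t₀ => ?_
  obtain ⟨U, hU, hxU, ι, _, φ, hφ, hφ'⟩ := hE.locally_trivial (x t₀)
  have hT : IsOpen (x ⁻¹' U) := hU.preimage hx
  have h₁ : ∀ k, Continuous fun t : ↥(x ⁻¹' U) => φ ⟨x t, t.2⟩ (s k t) := fun k =>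
    hφ.comp (((hs k).comp continuous_subtype_val).subtype_mk fun t => t.2)
  have h₂ : Continuous fun t : ↥(x ⁻¹' U) => ∑ k, c k t • φ ⟨x t, t.2⟩ (s k t) :=
    continuous_finsetSum _ fun k _ => ((hc k).comp continuous_subtype_val).smul (h₁ k)
  let i : ↥(x ⁻¹' U) → U := fun t => ⟨x t, t.2⟩
  have hi : Continuous i := (hx.comp continuous_subtype_val).subtype_mk _
  have h₃ := hφ'.comp (hi.prodMk h₂)
  refine (hT.isOpenEmbedding_subtypeVal.continuousAt_iff (x := ⟨t₀, hxU⟩)).1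
    (Continuous.continuousAt (h₃.congr fun t => ?_))
  refine congrArg (E.pt (x t)) ?_
  apply (φ ⟨x t, t.2⟩).injective
  refine ((φ ⟨x t, t.2⟩).apply_symm_apply _).trans ?_
  rw [map_sum]
  simp only [map_smul]

theorem IsVectorBundle.continuous_smul {E : Family.{u, v} p X} (hE : E.IsVectorBundle)
    {T : Type*} [TopologicalSpace T] {x : T → X} {c : T → ℂ} (hc : Continuous c)
    {s : ∀ t, E.fiber (x t)} (hs : Continuous fun t => E.pt (x t) (s t)) :
    Continuous fun t => E.pt (x t) (c t • s t) := by
  have := hE.continuous_sum_smul (κ := Unit) (x := x) (hE.continuous_proj.comp hs)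
    (fun _ => hc) (s := fun _ => s) (fun _ => hs)
  simpa using this

/-- The action of a single element is continuous on sections. -/
theorem IsVectorBundle.continuous_act_apply {E : Family.{u, v} p X} (hE : E.IsVectorBundle)
    {T : Type*} [TopologicalSpace T] (γ : Γ) {x y : T → X} (h : ∀ t, p γ • x t = y t)
    {s : ∀ t, E.fiber (x t)} (hs : Continuous fun t => E.pt (x t) (s t)) :
    Continuous fun t => E.pt (y t) (E.act γ (h t) (s t)) := by
  obtain rfl : (fun t => p γ • x t) = y := funext h
  exact hE.continuous_act.comp (continuous_const.prodMk hs)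

end Continuity

end Family

/-! ### Charts in which `A` acts by a constant representation. -/

section Charts

open Family

variable {G : Type w} [Group G] {A : Subgroup G} [A.Normal]
variable {X : Type u} [TopologicalSpace X] [MulAction (G ⧸ A) X]

theorem mk_coe_smul (a : A) (x : X) : QuotientGroup.mk' A (a : G) • x = x := by
  rw [show QuotientGroup.mk' A (a : G) = 1 from (QuotientGroup.eq_one_iff _).2 a.2, one_smul]

/-- A `G`-equivariant vector bundle on whose base `A` acts trivially is locally trivial as a
bundle of representations of the finite group `A`. -/
theorem exists_equivariant_chart [TopologicalSpace G] [Finite A]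
    (E : Family.{u, v} (QuotientGroup.mk' A) X) (hE : E.IsVectorBundle) (x₀ : X) :
    ∃ U : Set X, IsOpen U ∧ x₀ ∈ U ∧
      ∃ (ι : Type) (_ : Fintype ι) (R : Representation ℂ A (ι → ℂ))
        (θ : ∀ y : U, E.fiber y ≃ₗ[ℂ] (ι → ℂ)),
        (∀ y a e, θ y (fibRep E y a e) = R a (θ y e)) ∧
        Continuous (fun t : {t : E.Tot // E.proj t ∈ U} => θ ⟨E.proj t, t.2⟩ (E.vec t)) ∧
        Continuous (fun s : U × (ι → ℂ) => E.pt s.1 ((θ s.1).symm s.2)) := by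
  have := Fintype.ofFinite A
  obtain ⟨U, hU, hxU, ι, _, φ, hφ, hφ'⟩ := hE.locally_trivial x₀
  let R : ∀ _ : U, Representation ℂ A (ι → ℂ) := fun y =>
    { toFun := fun a => (φ y).toLinearMap ∘ₗ fibRep E y a ∘ₗ (φ y).symm.toLinearMap
      map_one' := by ext1 c; simp
      map_mul' := fun a b => by ext1 c; simp }
  have hR : ∀ y a e, φ y (fibRep E y a e) = R y a (φ y e) := fun y a e => by simp [R]
  let R₀ := R ⟨x₀, hxU⟩
  -- The identity map from the representation `R y` to `R₀` need not be equivariant; `T y` is its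
  -- average over `A`. It is an intertwiner from `R y` to `R₀`, depends continuously on `y`, and is
  -- the identity at `x₀`, so it is invertible near `x₀` and corrects the chart there.
  let T : U → ((ι → ℂ) →ₗ[ℂ] (ι → ℂ)) := fun y =>
    (Fintype.card A : ℂ)⁻¹ • ∑ a : A, R₀ a⁻¹ ∘ₗ R y a
  have hcard : (Fintype.card A : ℂ) ≠ 0 := Nat.cast_ne_zero.2 Fintype.card_ne_zero
  have hT₀ : T ⟨x₀, hxU⟩ = LinearMap.id := by
    have : ∀ a : A, R₀ a⁻¹ ∘ₗ R ⟨x₀, hxU⟩ a = LinearMap.id := fun a => by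
      change R₀ a⁻¹ * R₀ a = 1
      rw [← map_mul, inv_mul_cancel, map_one]
    simp only [T, this, Finset.sum_const, Finset.card_univ, ← Nat.cast_smul_eq_nsmul ℂ,
      smul_smul, inv_mul_cancel₀ hcard, one_smul]
  have hTe : ∀ y b c, T y (R y b c) = R₀ b (T y c) := fun y b c => by
    simp only [T, LinearMap.smul_apply, LinearMap.sum_apply, LinearMap.comp_apply, map_smul,
      map_sum]
    congr 1
    -- The substitution `a ↦ a b` matches the two sums, since `b (a b)⁻¹ = a⁻¹`.
    refine Fintype.sum_equiv (Equiv.mulRight b) _ _ fun a => ?_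
    rw [Equiv.coe_mulRight, ← Module.End.mul_apply (R y a), ← map_mul,
      ← Module.End.mul_apply (R₀ b), ← map_mul, mul_inv_rev, mul_inv_cancel_left]
  let T' : U → ((ι → ℂ) →L[ℂ] (ι → ℂ)) := fun y => (T y).toContinuousLinearMap
  have hT' : Continuous T' := by
    -- In finite dimension, continuity of a family of operators may be tested on single vectors.
    rw [continuous_clm_apply]
    intro c
    change Continuous fun y : U => T y c
    simp only [T, LinearMap.smul_apply, LinearMap.sum_apply, LinearMap.comp_apply]
    suffices h : ∀ a : A, Continuous fun y : U => R₀ a⁻¹ (R y a c) by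
      exact (continuous_const (y := (Fintype.card A : ℂ)⁻¹)).smul
        (continuous_finsetSum Finset.univ fun a _ => h a)
    intro a
    refine (R₀ a⁻¹).continuous_of_finiteDimensional.comp ?_
    have h₁ : Continuous fun y : U => E.pt y ((φ y).symm c) :=
      hφ'.comp (continuous_id.prodMk continuous_const)
    have h₂ := hE.continuous_act_apply (a : G) (fun y : U => mk_coe_smul a (y : X)) h₁
    exact hφ.comp (h₂.subtype_mk fun y => y.2)
  -- The locus where `T y` is invertible; it is open because the invertible operators form an open
  -- set. The new chart domain is its image in `X`.
  let S : Set U := T' ⁻¹' Set.range ((↑) : ((ι → ℂ) ≃L[ℂ] (ι → ℂ)) → _)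
  have hS : IsOpen S := ContinuousLinearEquiv.isOpen.preimage hT'
  have hxS : (⟨x₀, hxU⟩ : U) ∈ S := by
    refine ⟨ContinuousLinearEquiv.refl ℂ _, ?_⟩
    change _ = (T ⟨x₀, hxU⟩).toContinuousLinearMap
    rw [hT₀]; rfl
  have hmem : ∀ y : ↥(Subtype.val '' S), ∃ h : (y : X) ∈ U, (⟨y, h⟩ : U) ∈ S := by
    rintro ⟨_, y, hy, rfl⟩
    exact ⟨y.2, hy⟩
  let i : ↥(Subtype.val '' S) → U := fun y => ⟨y, (hmem y).1⟩
  have hi : Continuous i := continuous_subtype_val.subtype_mk _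
  choose B hB using fun y : ↥(Subtype.val '' S) => (hmem y).2
  replace hB : ∀ y, (B y : (ι → ℂ) →L[ℂ] (ι → ℂ)) = T' (i y) := hB
  have hBT : ∀ y c, B y c = T (i y) c := fun y c => DFunLike.congr_fun (hB y) c
  have hBc : Continuous fun y => (B y : (ι → ℂ) →L[ℂ] (ι → ℂ)) := by
    simp only [hB]
    exact hT'.comp hi
  -- The inverse chart needs inversion of operators to be continuous at invertible ones, which is
  -- differentiability of order `0` of `ContinuousLinearMap.inverse`.
  have hBc' : Continuous fun y => ((B y).symm : (ι → ℂ) →L[ℂ] (ι → ℂ)) := by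
    have : (fun y => ((B y).symm : (ι → ℂ) →L[ℂ] (ι → ℂ)))
        = fun y => ContinuousLinearMap.inverse (B y : (ι → ℂ) →L[ℂ] (ι → ℂ)) := by
      ext1 y; simp
    rw [this]
    refine continuous_iff_continuousAt.2 fun y => ?_
    have := (contDiffAt_map_inverse (𝕜 := ℂ) (n := 0) (B y)).continuousAt
    exact ContinuousAt.comp (f := fun y => (B y : (ι → ℂ) →L[ℂ] (ι → ℂ))) this hBc.continuousAt
  refine ⟨Subtype.val '' S, hU.isOpenEmbedding_subtypeVal.isOpenMap _ hS, ⟨_, hxS, rfl⟩, ι,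
    inferInstance, R₀, fun y => (φ (i y)).trans (B y).toLinearEquiv, fun y a e => ?_, ?_, ?_⟩
  · change B y (φ (i y) (fibRep E (i y) a e)) = R₀ a (B y (φ (i y) e))
    rw [hBT, hBT, hR, hTe]
  · let pr : {t : E.Tot // E.proj t ∈ Subtype.val '' S} → ↥(Subtype.val '' S) :=
      fun t => ⟨E.proj t, t.2⟩
    have hpr : Continuous pr :=
      (hE.continuous_proj.comp continuous_subtype_val).subtype_mk _
    exact (hBc.comp hpr).clm_apply (hφ.comp
      (continuous_subtype_val.subtype_mk fun t => (hmem ⟨E.proj t, t.2⟩).1))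
  · exact hφ'.comp ((hi.comp continuous_fst).prodMk
      ((hBc'.comp continuous_fst).clm_apply continuous_snd))

end Charts

theorem TwExt.continuous_z {Q : Type w} [Group Q] (α : NormCocycle Q) :
    Continuous fun γ : TwExt α => (γ.z : ℂ) :=
  continuous_subtype_val.comp (continuous_iff_le_induced.2 inf_le_right)

/-! ### Linear algebra and continuity for spaces of intertwining maps. -/

section Intertwining

variable {B V F F' : Type*} [Group B] [AddCommGroup V] [Module ℂ V] [AddCommGroup F]
  [Module ℂ F] [AddCommGroup F'] [Module ℂ F']

/-- An intertwining map as a linear map, linearly. -/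
def intertwiningToLinear (τ : Representation ℂ B V) (σ : Representation ℂ B F) :
    Representation.IntertwiningMap τ σ →ₗ[ℂ] V →ₗ[ℂ] F where
  toFun f := f.toLinearMap
  map_add' _ _ := rfl
  map_smul' _ _ := rfl

theorem intertwiningToLinear_injective (τ : Representation ℂ B V) (σ : Representation ℂ B F) :
    Function.Injective (intertwiningToLinear τ σ) :=
  Representation.IntertwiningMap.toLinearMap_injective _ _

instance [FiniteDimensional ℂ V] [FiniteDimensional ℂ F] (τ : Representation ℂ B V)
    (σ : Representation ℂ B F) : FiniteDimensional ℂ (Representation.IntertwiningMap τ σ) :=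
  FiniteDimensional.of_injective _ (intertwiningToLinear_injective τ σ)

/-- Composition of intertwining maps with an equivariant isomorphism. -/
def intertwiningCongr (τ : Representation ℂ B V) {σ : Representation ℂ B F}
    {σ' : Representation ℂ B F'} (θ : F ≃ₗ[ℂ] F') (h : ∀ b x, θ (σ b x) = σ' b (θ x)) :
    Representation.IntertwiningMap τ σ ≃ₗ[ℂ] Representation.IntertwiningMap τ σ' where
  toFun f := ⟨θ.toLinearMap ∘ₗ f.toLinearMap, fun b => LinearMap.ext fun x =>
    (congrArg θ (Representation.IntertwiningMap.isIntertwining _ _ f b x)).trans (h b (f x))⟩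
  map_add' f f' := Representation.IntertwiningMap.ext (LinearMap.comp_add _ _ _)
  map_smul' c f := Representation.IntertwiningMap.ext (LinearMap.comp_smul _ _ _)
  invFun f := ⟨θ.symm.toLinearMap ∘ₗ f.toLinearMap, fun b => LinearMap.ext fun x => by
    apply θ.injective
    change θ (θ.symm (f (τ b x))) = θ (σ b (θ.symm (f x)))
    rw [h, LinearEquiv.apply_symm_apply, LinearEquiv.apply_symm_apply]
    exact Representation.IntertwiningMap.isIntertwining _ _ f b x⟩
  left_inv f := Representation.IntertwiningMap.ext (LinearMap.ext fun x => θ.symm_apply_apply _)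
  right_inv f := Representation.IntertwiningMap.ext (LinearMap.ext fun x => θ.apply_symm_apply _)

/-- A linear function of intertwining maps depends continuously on their values. -/
theorem continuous_linear_intertwining {ι κ T : Type*} [Fintype ι] [Finite κ]
    [TopologicalSpace T] [FiniteDimensional ℂ V] (τ : Representation ℂ B V)
    (σ : Representation ℂ B (ι → ℂ))
    (l : Representation.IntertwiningMap τ σ →ₗ[ℂ] (κ → ℂ))
    {f : T → Representation.IntertwiningMap τ σ} (hf : ∀ x, Continuous fun t => f t x) :
    Continuous fun t => l (f t) := by
  let b := Module.finBasis ℂ V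
  -- Values at a basis of `V` embed the intertwining maps in a coordinate space. With a linear
  -- retraction `r` of this embedding, `l = (l ∘ r) ∘ i`, and `l ∘ r` is automatically continuous;
  -- no topology on the space of intertwining maps is needed.
  let i : Representation.IntertwiningMap τ σ →ₗ[ℂ] (Fin (Module.finrank ℂ V) → ι → ℂ) :=
    (b.constr ℂ).symm.toLinearMap ∘ₗ intertwiningToLinear τ σ
  have hi : LinearMap.ker i = ⊥ := LinearMap.ker_eq_bot.2
    ((b.constr ℂ).symm.injective.comp (intertwiningToLinear_injective τ σ))
  obtain ⟨r, hr⟩ := i.exists_leftInverse_of_injective hi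
  have h : ∀ g, l g = (l ∘ₗ r) (i g) := fun g =>
    congrArg l (DFunLike.congr_fun hr g).symm
  simp only [h]
  refine (l ∘ₗ r).continuous_of_finiteDimensional.comp (continuous_pi fun k => ?_)
  exact hf (b k)

end Intertwining

/-! ### The twisted bundle `Hom_A(V, E)`. -/

section HomBundle

open Family

variable {G : Type w} [Group G] {A : Subgroup G} [A.Normal]
variable {V : Type v} [NormedAddCommGroup V] [InnerProductSpace ℂ V] [FiniteDimensional ℂ V]
variable {ρ : A →* (V ≃ₗᵢ[ℂ] V)} [Representation.IsIrreducible (toRep ρ)] (D : Lifts ρ)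
variable {X : Type u} [TopologicalSpace X] [MulAction (G ⧸ A) X]

namespace Lifts

theorem mk_σ_smul {q : G ⧸ A} {x y : X} (h : q • x = y) :
    QuotientGroup.mk' A (D.σ q) • x = y := by
  rw [← h]; exact congrArg (· • x) (D.mk_σ q)

variable (E : Family.{u, v} (QuotientGroup.mk' A) X)

variable {D E} in
/-- A vector in a fibre of `Hom_A(V, E)` as an intertwining map. -/
abbrev homMap {x : X} (f : (homFamily D E).fiber x) :
    Representation.IntertwiningMap (toRep ρ) (fibRep E x) := f

theorem isInducing_homFamily :
    IsInducing fun t : (homFamily D E).Tot => (t.1, fun x : V => E.pt t.1 (homMap t.2 x)) := ⟨rfl⟩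

theorem continuous_homFamily_proj : Continuous (homFamily D E).proj :=
  continuous_fst.comp (isInducing_homFamily D E).continuous

theorem continuous_homFamily_eval (x : V) :
    Continuous fun t : (homFamily D E).Tot => E.pt t.1 (homMap t.2 x) :=
  (continuous_apply x).comp (continuous_snd.comp (isInducing_homFamily D E).continuous)

/-- The universal property of the topology of pointwise convergence, through which all maps into
`Hom_A(V, E)` are handled. -/
theorem continuous_homFamily {T : Type*} [TopologicalSpace T] {s : T → (homFamily D E).Tot}
    (h : Continuous fun t => (homFamily D E).proj (s t))
    (h' : ∀ a : V, Continuous fun t => E.pt (s t).1 (homMap (s t).2 a)) : Continuous s :=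
  (isInducing_homFamily D E).continuous_iff.2 (h.prodMk (continuous_pi h'))

/-- The normalisations `σ(1) = 1` and `M_1 = 1` leave nothing but the factor `z`. -/
theorem homFamily_act_circle (z : Circle) {x : X} (h : TwExt.proj D.α ⟨1, z⟩ • x = x)
    (f : (homFamily D E).fiber x) : (homFamily D E).act ⟨1, z⟩ h f = (z : ℂ) • f := by
  refine Representation.IntertwiningMap.ext (LinearMap.ext fun a => ?_)
  change (z : ℂ) • E.act (D.σ 1) _ (homMap f ((D.M 1)⁻¹ a)) = (z : ℂ) • homMap f a
  have hx : QuotientGroup.mk' A (1 : G) • x = x := by rw [map_one, one_smul]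
  rw [act_congr E D.σ_one _ hx, D.M_one, E.act_one]
  simp

/-- `Hom_A(V, E)` is a vector bundle. -/
theorem isVectorBundle_homFamily [TopologicalSpace G] [Finite A] [ContinuousConstSMul (G ⧸ A) X]
    (hE : E.IsVectorBundle) : (homFamily D E).IsVectorBundle where
  continuous_proj := continuous_homFamily_proj D E
  locally_trivial x₀ := by
    -- In an equivariant chart the fibres `Hom_A(V, E_y)` are all identified with the single
    -- finite-dimensional space `Hom_A(V, R)`, and a basis of that space gives the chart.
    obtain ⟨U, hU, hxU, ι, _, R, θ, hθe, hθ, hθ'⟩ := exists_equivariant_chart E hE x₀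
    let b := Module.finBasis ℂ (Representation.IntertwiningMap (toRep ρ) R)
    refine ⟨U, hU, hxU, Fin _, inferInstance, fun y =>
      (intertwiningCongr (toRep ρ) (θ y) (hθe y)).trans b.equivFun, ?_, ?_⟩
    · refine continuous_linear_intertwining (toRep ρ) R b.equivFun.toLinearMap fun a => ?_
      exact hθ.comp (((continuous_homFamily_eval D E a).comp continuous_subtype_val).subtype_mk
        fun t => t.2)
    · refine continuous_homFamily D E (continuous_subtype_val.comp continuous_fst) fun a => ?_
      have h : Continuous fun c : Fin _ → ℂ => (b.equivFun.symm c) a :=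
        ((LinearMap.applyₗ a ∘ₗ intertwiningToLinear (toRep ρ) R) ∘ₗ
          b.equivFun.symm.toLinearMap).continuous_of_finiteDimensional
      exact hθ'.comp (continuous_fst.prodMk (h.comp continuous_snd))
  continuous_act := by
    refine continuous_homFamily D E ?_ fun a => ?_
    · exact (continuous_baseAct (twistedKind.{v} D.α).locConst).comp
        (continuous_fst.prodMk ((continuous_homFamily_proj D E).comp continuous_snd))
    -- The class `q` is locally constant on the extension, so it may be fixed. The value at `a` of
    -- the transformed map is then `z σ(q)` applied to the value at the fixed vector `M_q⁻¹ a`.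
    · have := continuous_of_locallyConstant (twistedKind.{v} D.α).locConst
        (S := (homFamily D E).Tot)
        (fun q s => E.pt (q • s.2.1) ((s.1.z : ℂ) • E.act (D.σ q) (D.mk_σ_smul rfl)
          (homMap s.2.2 ((D.M q)⁻¹ a))))
        (fun q => hE.continuous_smul ((TwExt.continuous_z D.α).comp continuous_fst)
          (hE.continuous_act_apply (D.σ q) (fun s : TwExt D.α × (homFamily D E).Tot =>
            D.mk_σ_smul (x := s.2.1) rfl)
            ((continuous_homFamily_eval D E _).comp continuous_snd)))
      exact this

/-- The twisted bundle `Hom_A(V, E)`. -/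
def homBundle [Finite A] [ContinuousConstSMul (G ⧸ A) X] (E : Bundle.{u, v} (rhoKind ρ) X) :
    Bundle.{u, v} (twistedKind D.α) X where
  fam := homFamily D E.fam
  -- The explicit `⊥` is the discrete topology that `rhoKind` puts on `G`.
  isVB := @isVectorBundle_homFamily _ _ _ _ _ _ _ _ _ _ D _ _ _ E.fam ⊥ _ _ E.isVB
  cond x z f := D.homFamily_act_circle E.fam z (one_smul _ x) f

end Lifts

end HomBundle

/-! ### Equal group elements, bases of fibres, and families with scalar circle action. -/

namespace Family

section

variable {Γ : Type w'} [Group Γ] {Q : Type w} [Group Q] {p : Γ →* Q} {X : Type u}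
  [MulAction Q X]

/-- Rewriting the group element directly would disturb the proof that it carries `x` to `y`; here
both proofs are arbitrary. -/
theorem act_eq_of_eq (E : Family.{u, v} p X) {γ δ : Γ} (hγ : γ = δ) {x y : X}
    (h₁ : p γ • x = y) (h₂ : p δ • x = y) (e : E.fiber x) : E.act γ h₁ e = E.act δ h₂ e := by
  subst hγ; rfl

theorem IsVectorBundle.exists_finBasis [TopologicalSpace Γ] [TopologicalSpace X]
    {E : Family.{u, v} p X} (hE : E.IsVectorBundle) (x : X) :
    ∃ (ι : Type) (_ : Fintype ι), Nonempty (Module.Basis ι ℂ (E.fiber x)) := by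
  obtain ⟨U, -, hxU, ι, _, φ, -⟩ := hE.locally_trivial x
  exact ⟨ι, inferInstance, ⟨Module.Basis.ofEquivFun (φ ⟨x, hxU⟩)⟩⟩

end

end Family

section Twisted

variable {Q : Type w} [Group Q] {α : NormCocycle Q} {X : Type u} [MulAction Q X]

/-- The central circle acts by multiplication by scalars. -/
def IsTwisted (F : Family.{u, v} (TwExt.proj α) X) : Prop :=
  ∀ (x : X) (z : Circle) (f : F.fiber x), F.kerRep x (TwExt.circle α z) f = (z : ℂ) • f

/-- Since `α(q, 1) = 1`, one has `(q, z) = (q, 1)(1, z)`. Hence a twisted action is determined by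
the elements `(q, 1)`. -/
theorem IsTwisted.act_eq {F : Family.{u, v} (TwExt.proj α) X} (hF : IsTwisted F) (q : Q)
    (z : Circle) {x y : X} (h : q • x = y) (f : F.fiber x) :
    F.act ⟨q, z⟩ h f = (z : ℂ) • F.act ⟨q, 1⟩ h f := by
  have h₁ : TwExt.proj α (TwExt.circle α z) • x = x := one_smul Q x
  have h₂ : (⟨q, z⟩ : TwExt α) = ⟨q, 1⟩ * TwExt.circle α z := by
    refine TwExt.ext (mul_one q).symm ?_
    change z = α.toFun q 1 * 1 * z
    rw [α.one_right, one_mul, one_mul]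
  have h₃ : TwExt.proj α (⟨q, 1⟩ * TwExt.circle α z) • x = y := by rw [← h₂]; exact h
  rw [F.act_eq_of_eq h₂ h h₃, F.act_mul _ _ h₁ h h₃, ← map_smul]
  exact congrArg _ (hF x z f)

end Twisted

/-! ### The projective extension of `ρ` to `G` and the bundle `V ⊗ F`. -/

namespace Lifts

open Family

variable {G : Type w} [Group G] {A : Subgroup G} [A.Normal]
variable {V : Type v} [NormedAddCommGroup V] [InnerProductSpace ℂ V]
variable {ρ : A →* (V ≃ₗᵢ[ℂ] V)} (D : Lifts ρ)

/-- The element `a ∈ A` with `g = σ(q) a`, where `q` is the class of `g`. -/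
def rem (g : G) : A :=
  ⟨(D.σ (QuotientGroup.mk g))⁻¹ * g, by rw [← QuotientGroup.eq, D.mk_σ]⟩

/-- The projective representation `σ(q) a ↦ M_q ρ(a)` of `G` extending `ρ`. -/
def projRep (g : G) : V ≃ₗᵢ[ℂ] V := D.M (QuotientGroup.mk g) * ρ (D.rem g)

theorem projRep_coe (a : A) : D.projRep a = ρ a := by
  have h : (QuotientGroup.mk (a : G) : G ⧸ A) = 1 := (QuotientGroup.eq_one_iff _).2 a.2
  have h' : D.rem a = a := by
    ext
    simp [rem, h, D.σ_one]
  rw [projRep, h, D.M_one, one_mul, h']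

theorem projRep_one : D.projRep 1 = 1 := by
  have := D.projRep_coe 1
  rwa [map_one] at this

theorem projRep_σ (q : G ⧸ A) : D.projRep (D.σ q) = D.M q := by
  have h' : D.rem (D.σ q) = 1 := by
    ext
    simp [rem, D.mk_σ]
  rw [projRep, h', map_one, mul_one, D.mk_σ]

variable [FiniteDimensional ℂ V] [Representation.IsIrreducible (toRep ρ)]

/-- Moving `ρ(rem g)` past `M_h̄` conjugates it by `σ(h̄)`, and `M_ḡ M_h̄` is compared with the `M`
of the product by `αfun_spec''`. The factors from `A` then combine to `rem (g * h)`, so the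
multiplier is exactly `α_ρ`, evaluated on the classes of `g` and `h`. -/
theorem projRep_mul (g h : G) (x : V) :
    D.projRep (g * h) x = (D.αfun (QuotientGroup.mk g) (QuotientGroup.mk h) : ℂ) •
      D.projRep g (D.projRep h x) := by
  have h₁ := DFunLike.congr_fun (D.conj' (QuotientGroup.mk h) (D.rem g)) (ρ (D.rem h) x)
  have h₂ : D.χ (QuotientGroup.mk g) (QuotientGroup.mk h) *
      (MulAut.conjNormal (D.σ (QuotientGroup.mk h))⁻¹ (D.rem g) * D.rem h) = D.rem (g * h) := by
    ext
    simp [χ, rem, mul_assoc]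
  change _ = (D.αfun _ _ : ℂ) • D.M _ ((ρ (D.rem g) * D.M (QuotientGroup.mk h)) (ρ (D.rem h) x))
  rw [h₁]
  change _ = (D.αfun _ _ : ℂ) • D.M _ (D.M _ (ρ _ (ρ (D.rem h) x)))
  rw [D.αfun_spec'', projRep, ← h₂, map_mul, map_mul]
  rfl

variable {X : Type u} [TopologicalSpace X] [MulAction (G ⧸ A) X]

/-- The family `V ⊗ F` with the action `g (x ⊗ f) = M_q ρ(a) x ⊗ (q, 1) f` for `g = σ(q) a`, with
the topology of `Family.tensor`. -/
def tensorFamily (F : Family.{u, v} (TwExt.proj D.α) X) (hF : IsTwisted F) :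
    Family.{u, v} (QuotientGroup.mk' A) X where
  fiber x := V ⊗[ℂ] F.fiber x
  top := TopologicalSpace.induced
    (fun t => (t.1, fun φ : Module.Dual ℂ V => F.pt t.1 (contract φ t.2))) inferInstance
  act g _ _ h := TensorProduct.map (D.projRep g).toLinearEquiv.toLinearMap
    (F.act ⟨QuotientGroup.mk g, 1⟩ h)
  act_one {x} h e := by
    refine tmul_equiv_of_tmul (g := LinearMap.id) (fun a b => ?_) e
    rw [TensorProduct.map_tmul, D.projRep_one]
    exact congrArg (a ⊗ₜ[ℂ] ·) (F.act_one h b)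
  act_mul g h x y z h₁ h₂ h₃ e := by
    refine tmul_equiv_of_tmul
      (g := TensorProduct.map (D.projRep g).toLinearEquiv.toLinearMap
          (F.act ⟨QuotientGroup.mk g, 1⟩ h₂) ∘ₗ
        TensorProduct.map (D.projRep h).toLinearEquiv.toLinearMap
          (F.act ⟨QuotientGroup.mk h, 1⟩ h₁)) (fun a b => ?_) e
    change D.projRep (g * h) a ⊗ₜ[ℂ] F.act ⟨QuotientGroup.mk (g * h), 1⟩ h₃ b
      = D.projRep g (D.projRep h a) ⊗ₜ[ℂ]
        F.act ⟨QuotientGroup.mk g, 1⟩ h₂ (F.act ⟨QuotientGroup.mk h, 1⟩ h₁ b)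
    -- The scalar `α` produced by the projective representation is moved to the factor `F`, where it
    -- is the circle coordinate of `(ḡ, 1)(h̄, 1)`; this is where the twist cancels.
    rw [← F.act_mul ⟨QuotientGroup.mk g, 1⟩ ⟨QuotientGroup.mk h, 1⟩ h₁ h₂ h₃, D.projRep_mul,
      TensorProduct.smul_tmul]
    refine congrArg _ ?_
    have : (⟨QuotientGroup.mk g, 1⟩ * ⟨QuotientGroup.mk h, 1⟩ : TwExt D.α)
        = ⟨QuotientGroup.mk (g * h), D.αfun (QuotientGroup.mk g) (QuotientGroup.mk h)⟩ := by
      refine TwExt.ext rfl ?_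
      change D.αfun _ _ * 1 * 1 = _
      rw [mul_one, mul_one]
    rw [F.act_eq_of_eq this h₃ h₃]
    exact (hF.act_eq _ _ h₃ b).symm

variable {F : Family.{u, v} (TwExt.proj D.α) X} (hF : IsTwisted F)

theorem isInducing_tensorFamily :
    IsInducing fun t : (D.tensorFamily F hF).Tot =>
      (t.1, fun φ : Module.Dual ℂ V => F.pt t.1 (contract φ t.2)) := ⟨rfl⟩

theorem continuous_tensorFamily_proj : Continuous (D.tensorFamily F hF).proj :=
  continuous_fst.comp (D.isInducing_tensorFamily hF).continuous

theorem continuous_tensorFamily_contract (φ : Module.Dual ℂ V) :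
    Continuous fun t : (D.tensorFamily F hF).Tot => F.pt t.1 (contract φ t.2) :=
  (continuous_apply φ).comp (continuous_snd.comp (D.isInducing_tensorFamily hF).continuous)

theorem continuous_tensorFamily {T : Type*} [TopologicalSpace T]
    {s : T → (D.tensorFamily F hF).Tot}
    (h : Continuous fun t => (D.tensorFamily F hF).proj (s t))
    (h' : ∀ φ : Module.Dual ℂ V, Continuous fun t => F.pt (s t).1 (contract φ (s t).2)) :
    Continuous s :=
  (D.isInducing_tensorFamily hF).continuous_iff.2 (h.prodMk (continuous_pi h'))

theorem isVectorBundle_tensorFamily [TopologicalSpace G] [DiscreteTopology G]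
    [ContinuousConstSMul (G ⧸ A) X] (hV : F.IsVectorBundle) :
    (D.tensorFamily F hF).IsVectorBundle where
  continuous_proj := D.continuous_tensorFamily_proj hF
  locally_trivial :=
    -- Local triviality does not involve the action, and the total space is the same as for the
    -- tensor product with the trivial representation on `V`.
    (hV.tensor ⟨V, (1 : Representation ℂ (G ⧸ A) V)⟩
      (twistedKind.{v} D.α).locConst).locally_trivial
  continuous_act := by
    refine D.continuous_tensorFamily hF ?_ fun φ => ?_
    · exact (continuous_baseAct (IsLocallyConstant.of_discrete _)).comp
        (continuous_fst.prodMk ((D.continuous_tensorFamily_proj hF).comp continuous_snd))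
    -- For fixed `g`, contracting with `φ` after the action is the same as contracting with `φ ∘
    -- P(g)` and then acting on `F`.
    · refine continuous_prod_of_discrete_left.2 fun g => ?_
      have := hV.continuous_act_apply ⟨QuotientGroup.mk g, 1⟩
        (x := fun t : (D.tensorFamily F hF).Tot => t.1) (fun t => rfl)
        (D.continuous_tensorFamily_contract hF (φ ∘ₗ (D.projRep g).toLinearEquiv.toLinearMap))
      refine this.congr fun t => congrArg (F.pt _) ?_
      exact tmul_equiv_of_tmul
        (f := F.act ⟨QuotientGroup.mk g, 1⟩ rfl ∘ₗ
          contract (φ ∘ₗ (D.projRep g).toLinearEquiv.toLinearMap))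
        (g := contract φ ∘ₗ TensorProduct.map (D.projRep g).toLinearEquiv.toLinearMap
          (F.act ⟨QuotientGroup.mk g, 1⟩ rfl)) (fun a b => by simp) t.2

/-- By Schur's lemma `Hom_A(V, V)` is spanned by the identity, so `x ↦ x ⊗ id` is inverse to
evaluation. -/
theorem bijective_evalMap_self : Function.Bijective (evalMap (toRep ρ) (toRep ρ)) := by
  have hV : Nontrivial V := nontrivial (ρ := ρ)
  let i : Representation.IntertwiningMap (toRep ρ) (toRep ρ) := .id _
  have h : ∀ t : V ⊗[ℂ] Representation.IntertwiningMap (toRep ρ) (toRep ρ),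
      evalMap (toRep ρ) (toRep ρ) t ⊗ₜ[ℂ] i = t := fun t => by
    refine tmul_equiv_of_tmul (g := LinearMap.id)
      (f := (TensorProduct.mk ℂ V _).flip i ∘ₗ evalMap (toRep ρ) (toRep ρ)) (fun x f => ?_) t
    obtain ⟨c, hc⟩ := exists_eq_smul_of_commute (ρ := ρ) f.toLinearMap fun a x =>
      Representation.IntertwiningMap.isIntertwining _ _ f a x
    have hf : f = c • i := Representation.IntertwiningMap.ext (LinearMap.ext hc)
    change f x ⊗ₜ[ℂ] i = x ⊗ₜ[ℂ] f
    rw [hf, ← TensorProduct.smul_tmul]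
    rfl
  exact ⟨fun t t' ht => by rw [← h t, ht, h], fun x => ⟨x ⊗ₜ[ℂ] i, rfl⟩⟩

/-- An element of `A` has trivial class, so it acts on the factor `F` through the unit of the
extension, and `P` restricts to `ρ` on `A`. -/
theorem fibRep_tensorFamily (x : X) (a : A) (t : V ⊗[ℂ] F.fiber x) :
    fibRep (D.tensorFamily F hF) x a t
      = LinearMap.rTensor (F.fiber x) (ρ a).toLinearEquiv.toLinearMap t := by
  refine tmul_equiv_of_tmul (f := fibRep (D.tensorFamily F hF) x a)
    (g := LinearMap.rTensor (F.fiber x) (ρ a).toLinearEquiv.toLinearMap) (fun b f => ?_) t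
  have h₁ : TwExt.proj D.α 1 • x = x := by rw [map_one, one_smul]
  change D.projRep a b ⊗ₜ[ℂ] F.act ⟨QuotientGroup.mk (a : G), 1⟩ _ f = ρ a b ⊗ₜ[ℂ] f
  rw [D.projRep_coe]
  have h₂ : (⟨QuotientGroup.mk (a : G), 1⟩ : TwExt D.α) = 1 :=
    TwExt.ext ((QuotientGroup.eq_one_iff _).2 a.2) rfl
  exact congrArg _ ((F.act_eq_of_eq h₂ _ h₁ f).trans (F.act_one h₁ f))

/-- A basis of `N` splits `V ⊗ N` into finitely many copies of `V`, with projections `id ⊗ b.coord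
k` and inclusions `y ↦ y ⊗ b k`; this reduces the claim to `V` itself through `bijective_evalMap`.
-/
theorem bijective_evalMap_rTensor {N κ : Type*} [Fintype κ] [AddCommGroup N] [Module ℂ N]
    (b : Module.Basis κ ℂ N) (σ : Representation ℂ A (V ⊗[ℂ] N))
    (hσ : ∀ a t, σ a t = LinearMap.rTensor N (ρ a).toLinearEquiv.toLinearMap t) :
    Function.Bijective (evalMap (toRep ρ) σ) := by
  refine bijective_evalMap (κ := κ) (F' := fun _ => V) (σ' := fun _ => toRep ρ) _
    (fun k => (TensorProduct.rid ℂ V).toLinearMap ∘ₗ LinearMap.lTensor V (b.coord k))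
    (fun k => (TensorProduct.mk ℂ V N).flip (b k)) (fun k a t => ?_)
    (fun k a y => ?_) (fun t => ?_) (fun k => bijective_evalMap_self)
  · rw [hσ]
    exact tmul_equiv_of_tmul
      (f := ((TensorProduct.rid ℂ V).toLinearMap ∘ₗ LinearMap.lTensor V (b.coord k)) ∘ₗ
        LinearMap.rTensor N (ρ a).toLinearEquiv.toLinearMap)
      (g := toRep ρ a ∘ₗ
        (TensorProduct.rid ℂ V).toLinearMap ∘ₗ LinearMap.lTensor V (b.coord k))
      (fun y f => by simp) t
  · rw [hσ]
    rfl
  · have := tmul_equiv_of_tmul (g := LinearMap.id)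
      (f := ∑ k, (TensorProduct.mk ℂ V N).flip (b k) ∘ₗ
        (TensorProduct.rid ℂ V).toLinearMap ∘ₗ LinearMap.lTensor V (b.coord k))
      (fun y f => by
        simp only [LinearMap.sum_apply, LinearMap.comp_apply, LinearMap.lTensor_tmul,
          LinearEquiv.coe_coe, TensorProduct.rid_tmul, LinearMap.flip_apply,
          TensorProduct.mk_apply, TensorProduct.smul_tmul, ← TensorProduct.tmul_sum,
          LinearMap.id_apply]
        congr 1
        exact b.sum_repr f) t
    rw [LinearMap.sum_apply] at this
    exact this

/-- The `(G, ρ)`-equivariant bundle `V ⊗ F`. -/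
def tensorBundle [ContinuousConstSMul (G ⧸ A) X] (F : Bundle.{u, v} (twistedKind D.α) X) :
    Bundle.{u, v} (rhoKind ρ) X where
  fam := D.tensorFamily F.fam F.cond
  isVB := by
    let _ : TopologicalSpace G := ⊥
    have : DiscreteTopology G := ⟨rfl⟩
    exact D.isVectorBundle_tensorFamily F.cond F.isVB
  cond x := by
    obtain ⟨κ, _, ⟨b⟩⟩ := F.isVB.exists_finBasis x
    exact bijective_evalMap_rTensor b _ (D.fibRep_tensorFamily F.cond x)

end Lifts

/-! ### The two constructions are inverse up to isomorphism: evaluation and coevaluation. -/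

namespace Lifts

open Family

variable {G : Type w} [Group G] {A : Subgroup G} [A.Normal]
variable {V : Type v} [NormedAddCommGroup V] [InnerProductSpace ℂ V] [FiniteDimensional ℂ V]
variable {ρ : A →* (V ≃ₗᵢ[ℂ] V)} [Representation.IsIrreducible (toRep ρ)] (D : Lifts ρ)
variable {X : Type u} [TopologicalSpace X] [MulAction (G ⧸ A) X]

section Evaluation

variable (E : Family.{u, v} (QuotientGroup.mk' A) X) (hT : IsTwisted (homFamily D E))

theorem act_σ_rem (g : G) {x y : X} (h : QuotientGroup.mk' A g • x = y) (e : E.fiber x) :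
    E.act (D.σ (QuotientGroup.mk g)) (D.mk_σ_smul h) (fibRep E x (D.rem g) e) = E.act g h e := by
  have h₁ : D.σ (QuotientGroup.mk g) * (D.rem g : G) = g := by simp [rem]
  have h₂ : QuotientGroup.mk' A (D.σ (QuotientGroup.mk g) * (D.rem g : G)) • x = y := by
    rw [h₁, h]
  rw [fibRep_apply E x _ (mk_coe_smul _ _), ← E.act_mul _ _ _ _ h₂]
  exact act_congr E h₁ _ _ _

/-- The evaluation `V ⊗ Hom_A(V, E) → E` on the fibre at `x`. -/
def homEval (x : X) : V ⊗[ℂ] (homFamily D E).fiber x →ₗ[ℂ] E.fiber x :=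
  evalMap (toRep ρ) (fibRep E x)

theorem homEval_tmul (x : X) (a : V) (f : (homFamily D E).fiber x) :
    D.homEval E x (a ⊗ₜ[ℂ] f) = homMap f a := rfl

/-- With `g = σ(q) a`, the factor `M_q⁻¹` of the action on `Hom_A(V, E)` cancels `M_q` in `P(g)` and
leaves `ρ(a)`. By `A`-equivariance of `f` this becomes the action of `a` on `E`, which together with
`σ(q)` is that of `g`. -/
theorem homEval_act (g : G) {x y : X} (h : QuotientGroup.mk' A g • x = y)
    (t : V ⊗[ℂ] (homFamily D E).fiber x) :
    D.homEval E y ((D.tensorFamily (homFamily D E) hT).act g h t)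
      = E.act g h (D.homEval E x t) := by
  refine tmul_equiv_of_tmul
    (f := D.homEval E y ∘ₗ TensorProduct.map (D.projRep g).toLinearEquiv.toLinearMap
      ((homFamily D E).act ⟨QuotientGroup.mk g, 1⟩ h))
    (g := E.act g h ∘ₗ D.homEval E x) (fun a f => ?_) t
  change ((1 : Circle) : ℂ) • E.act (D.σ (QuotientGroup.mk g)) (D.mk_σ_smul h)
    (homMap f ((D.M (QuotientGroup.mk g))⁻¹ (D.projRep g a))) = E.act g h (homMap f a)
  have h₁ : (D.M (QuotientGroup.mk g))⁻¹ (D.projRep g a) = ρ (D.rem g) a := by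
    simp [projRep]
  have h₂ : homMap f (ρ (D.rem g) a) = fibRep E x (D.rem g) (homMap f a) :=
    Representation.IntertwiningMap.isIntertwining _ _ (homMap f) _ _
  rw [h₁, h₂, Circle.coe_one, one_smul, D.act_σ_rem]

theorem continuous_homEval [TopologicalSpace G] (hE : E.IsVectorBundle) :
    Continuous fun t : (D.tensorFamily (homFamily D E) hT).Tot =>
      E.pt t.1 (D.homEval E t.1 t.2) := by
  let b := Module.finBasis ℂ V
  -- Expanding the tensor in a basis of `V` makes the evaluation a finite sum of evaluations at
  -- fixed basis vectors, each continuous for the topology of pointwise convergence.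
  have h := hE.continuous_sum_smul
    (x := fun t : (D.tensorFamily (homFamily D E) hT).Tot => t.1)
    (D.continuous_tensorFamily_proj hT) (c := fun _ _ => 1) (fun _ => continuous_const)
    (s := fun k t => homMap (contract (b.coord k) t.2) (b k))
    (fun k => (D.continuous_homFamily_eval E (b k)).comp
      (D.continuous_tensorFamily_contract hT (b.coord k)))
  refine h.congr fun t => congrArg (E.pt t.1) ?_
  refine Eq.trans ?_ (congrArg (D.homEval E t.1)
    (sum_contract (F := (homFamily D E).fiber t.1) b t.2))
  rw [map_sum]
  simp only [one_smul, homEval_tmul]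

end Evaluation

/-- `V ⊗ Hom_A(V, E) ≅ E` for a `(G, ρ)`-equivariant bundle `E`. -/
theorem cls_tensorBundle_homBundle [Finite A] [ContinuousConstSMul (G ⧸ A) X]
    (E : Bundle.{u, v} (rhoKind ρ) X) : (D.tensorBundle (D.homBundle E)).cls = E.cls := by
  refine Bundle.cls_eq (fun x => LinearEquiv.ofBijective _ (E.cond x)) (fun g x y h t => ?_) ?_
  · exact D.homEval_act E.fam (D.homBundle E).cond g h t
  · exact @continuous_homEval _ _ _ _ _ _ _ _ _ _ D _ _ _ E.fam (D.homBundle E).cond ⊥ E.isVB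

section Coevaluation

variable (F : Family.{u, v} (TwExt.proj D.α) X) (hF : IsTwisted F)

/-- The map `F → Hom_A(V, V ⊗ F)`. -/
def coev (x : X) : F.fiber x →ₗ[ℂ] (homFamily D (D.tensorFamily F hF)).fiber x where
  toFun f := ⟨(TensorProduct.mk ℂ V (F.fiber x)).flip f, fun a => LinearMap.ext fun y =>
    (D.fibRep_tensorFamily hF x a (y ⊗ₜ[ℂ] f)).symm⟩
  map_add' f f' := Representation.IntertwiningMap.ext (map_add _ f f')
  map_smul' c f := Representation.IntertwiningMap.ext (map_smul _ c f)

/-- Evaluation after `V ⊗ coev` is the identity, so `V ⊗ coev` is bijective when evaluation is. As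
`V` is nonzero it is faithfully flat over `ℂ`, and tensoring with it reflects bijectivity. -/
theorem bijective_coev (x : X)
    (h : Function.Bijective (evalMap (toRep ρ) (fibRep (D.tensorFamily F hF) x))) :
    Function.Bijective (D.coev F hF x) := by
  have : Nontrivial V := nontrivial (ρ := ρ)
  rw [← Module.FaithfullyFlat.lTensor_bijective_iff_bijective ℂ V (D.coev F hF x)]
  have h₁ : evalMap (toRep ρ) (fibRep (D.tensorFamily F hF) x) ∘ (D.coev F hF x).lTensor V
      = id := funext fun t => tmul_equiv_of_tmul (W := V) (W' := F.fiber x)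
    (f := evalMap (toRep ρ) (fibRep (D.tensorFamily F hF) x) ∘ₗ (D.coev F hF x).lTensor V)
    (g := LinearMap.id) (fun a b => rfl) t
  refine (Function.Bijective.of_comp_iff' h _).1 ?_
  rw [h₁]
  exact Function.bijective_id

/-- `P(σ(q)) = M_q` undoes `M_q⁻¹` on the factor `V`; on `F` there remains `z (q, 1) f`, which is
`(q, z) f` for a twisted family. -/
theorem coev_act (γ : TwExt D.α) {x y : X} (h : TwExt.proj D.α γ • x = y) (f : F.fiber x) :
    D.coev F hF y (F.act γ h f)
      = (homFamily D (D.tensorFamily F hF)).act γ h (D.coev F hF x f) := by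
  refine Representation.IntertwiningMap.ext (LinearMap.ext fun a => ?_)
  change (a ⊗ₜ[ℂ] F.act γ h f : V ⊗[ℂ] F.fiber y)
    = (γ.z : ℂ) • (D.projRep (D.σ γ.q) ((D.M γ.q)⁻¹ a) ⊗ₜ[ℂ]
        F.act ⟨QuotientGroup.mk (D.σ γ.q), 1⟩ _ f)
  have h₁ : D.projRep (D.σ γ.q) ((D.M γ.q)⁻¹ a) = a := by
    rw [D.projRep_σ]; simp
  have h₂ : (⟨QuotientGroup.mk (D.σ γ.q), 1⟩ : TwExt D.α) = ⟨γ.q, 1⟩ :=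
    TwExt.ext (D.mk_σ γ.q) rfl
  rw [h₁, ← TensorProduct.tmul_smul]
  refine congrArg _ ((hF.act_eq γ.q γ.z h f).trans (congrArg _ ?_))
  exact F.act_eq_of_eq h₂.symm _ _ f

theorem continuous_coev (hV : F.IsVectorBundle) :
    Continuous (totMap (E := F) (F := homFamily D (D.tensorFamily F hF)) (D.coev F hF)) := by
  refine D.continuous_homFamily _ hV.continuous_proj fun a => ?_
  refine D.continuous_tensorFamily hF hV.continuous_proj fun φ => ?_
  -- Evaluating at `a` and contracting with `φ` turns the coevaluation into multiplication by the
  -- constant `φ a`.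
  have : Continuous fun t : F.Tot => F.pt t.1 (φ a • t.2) :=
    hV.continuous_smul continuous_const continuous_id
  refine this.congr fun t => congrArg (F.pt t.1) ?_
  exact (contract_tmul φ a t.2).symm

end Coevaluation

/-- `F ≅ Hom_A(V, V ⊗ F)` for a twisted bundle `F`. -/
theorem cls_homBundle_tensorBundle [Finite A] [ContinuousConstSMul (G ⧸ A) X]
    (F : Bundle.{u, v} (twistedKind D.α) X) : (D.homBundle (D.tensorBundle F)).cls = F.cls := by
  refine Eq.symm (Bundle.cls_eq (fun x => LinearEquiv.ofBijective (D.coev F.fam F.cond x)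
    (D.bijective_coev F.fam F.cond x ((D.tensorBundle F).cond x))) (fun γ x y h f => ?_) ?_)
  · exact D.coev_act F.fam F.cond γ h f
  · exact D.continuous_coev F.fam F.cond F.isVB

end Lifts

/-! ### Passage from isomorphism classes to Grothendieck groups and kernels. -/

section Congr

variable {Q : Type w} [Group Q] {𝒯 𝒯' : Kind.{v, w, w'} Q}

/-- The isomorphism of `K`-groups induced by an isomorphism of semimodules of classes. -/
def K0.congr {X : Type u} [TopologicalSpace X] [MulAction Q X] [ContinuousConstSMul Q X]
    (e : Vec.{u, v} 𝒯 X ≃ₗ[RepClass.{v} Q] Vec.{u, v} 𝒯' X) :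
    K0.{u, v} 𝒯 X ≃ₗ[RepRing.{v} Q] K0.{u, v} 𝒯' X where
  toFun := grothMap e.toLinearMap.toAddMonoidHom
  map_add' := map_add (grothMap e.toLinearMap.toAddMonoidHom)
  map_smul' := grothMap_smul e.toLinearMap
  invFun := grothMap e.symm.toLinearMap.toAddMonoidHom
  left_inv x := by
    induction x using groth_induction with
    | add a a' h h' => exact (congrArg _ (map_add _ _ _)).trans ((map_add _ _ _).trans
        (congrArg₂ (· + ·) h h'))
    | neg a h => exact (congrArg _ (map_neg _ _)).trans ((map_neg _ _).trans (congrArg Neg.neg h))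
    | of m =>
      rw [grothMap_of, grothMap_of]
      exact congrArg gOf (e.symm_apply_apply m)
  right_inv x := by
    induction x using groth_induction with
    | add a a' h h' => exact (congrArg _ (map_add _ _ _)).trans ((map_add _ _ _).trans
        (congrArg₂ (· + ·) h h'))
    | neg a h => exact (congrArg _ (map_neg _ _)).trans ((map_neg _ _).trans (congrArg Neg.neg h))
    | of m =>
      rw [grothMap_of, grothMap_of]
      exact congrArg gOf (e.apply_symm_apply m)

theorem K0.congr_gOf {X : Type u} [TopologicalSpace X] [MulAction Q X] [ContinuousConstSMul Q X]
    (e : Vec.{u, v} 𝒯 X ≃ₗ[RepClass.{v} Q] Vec.{u, v} 𝒯' X) (a : Vec.{u, v} 𝒯 X) :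
    K0.congr e (gOf a) = gOf (e a) :=
  grothMap_of _ _

theorem K0.congr_pull {X Y : Type u} [TopologicalSpace X] [MulAction Q X]
    [ContinuousConstSMul Q X] [TopologicalSpace Y] [MulAction Q Y] [ContinuousConstSMul Q Y]
    (e : Vec.{u, v} 𝒯 X ≃ₗ[RepClass.{v} Q] Vec.{u, v} 𝒯' X)
    (e' : Vec.{u, v} 𝒯 Y ≃ₗ[RepClass.{v} Q] Vec.{u, v} 𝒯' Y) (f : EqMap Q X Y)
    (h : ∀ a, e (Vec.pull f a) = Vec.pull f (e' a)) (ξ : K0.{u, v} 𝒯 Y) :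
    K0.congr e (K0.pull f ξ) = K0.pull f (K0.congr e' ξ) := by
  change grothMap e.toLinearMap.toAddMonoidHom
      (grothMap (Vec.pullHom (𝒯 := 𝒯) f).toAddMonoidHom ξ) =
    grothMap (Vec.pullHom (𝒯 := 𝒯') f).toAddMonoidHom
      (grothMap e'.toLinearMap.toAddMonoidHom ξ)
  induction ξ using groth_induction with
  | add a a' h h' => simp only [map_add, h, h']
  | neg a h => simp only [map_neg, h]
  | of m =>
    rw [grothMap_of, grothMap_of, grothMap_of, grothMap_of]
    exact congrArg gOf (h m)

/-- A linear equivalence which is compatible with given linear maps restricts to their kernels. -/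
def kerCongr {R M N M' N' : Type*} [Ring R] [AddCommGroup M] [AddCommGroup N] [AddCommGroup M']
    [AddCommGroup N'] [Module R M] [Module R N] [Module R M'] [Module R N'] {f : M →ₗ[R] N}
    {f' : M' →ₗ[R] N'} (e : M ≃ₗ[R] M') (e' : N ≃ₗ[R] N') (h : ∀ x, e' (f x) = f' (e x)) :
    LinearMap.ker f ≃ₗ[R] LinearMap.ker f' :=
  e.ofSubmodules _ _ (by
    ext y
    rw [Submodule.mem_map_equiv, LinearMap.mem_ker, LinearMap.mem_ker,
      ← e'.map_eq_zero_iff, h, e.apply_symm_apply])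

end Congr

/-! ### Linearity and naturality on isomorphism classes, and the isomorphisms of `K`-groups. -/

namespace Lifts

open Family

variable {G : Type w} [Group G] {A : Subgroup G} [A.Normal] [Finite A]
variable {V : Type v} [NormedAddCommGroup V] [InnerProductSpace ℂ V] [FiniteDimensional ℂ V]
variable {ρ : A →* (V ≃ₗᵢ[ℂ] V)} [Representation.IsIrreducible (toRep ρ)] (D : Lifts ρ)
variable {X : Type u} [TopologicalSpace X] [MulAction (G ⧸ A) X] [ContinuousConstSMul (G ⧸ A) X]
variable {Y : Type u} [TopologicalSpace Y] [MulAction (G ⧸ A) Y] [ContinuousConstSMul (G ⧸ A) Y]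

/-- The map `[F] ↦ [V ⊗ F]` on isomorphism classes. -/
def tensorVec : Vec.{u, v} (twistedKind D.α) X → Vec.{u, v} (rhoKind ρ) X :=
  Quotient.map D.tensorBundle fun F F' ⟨e, h, hc, _⟩ => by
    refine iso_of_continuous (D.tensorBundle F).isVB (D.tensorBundle F').isVB
      (fun x => LinearEquiv.lTensor V (e x)) (fun g x y hxy t => ?_) ?_
    · exact tmul_equiv_of_tmul
        (f := (LinearEquiv.lTensor V (e y)).toLinearMap ∘ₗ
          TensorProduct.map (D.projRep g).toLinearEquiv.toLinearMap
            (F.fam.act ⟨QuotientGroup.mk g, 1⟩ hxy))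
        (g := TensorProduct.map (D.projRep g).toLinearEquiv.toLinearMap
            (F'.fam.act ⟨QuotientGroup.mk g, 1⟩ hxy) ∘ₗ
          (LinearEquiv.lTensor V (e x)).toLinearMap)
        (fun a b => congrArg (D.projRep g a ⊗ₜ[ℂ] ·) (h _ x y hxy b)) t
    · refine D.continuous_tensorFamily F'.cond (D.continuous_tensorFamily_proj F.cond) fun φ => ?_
      refine (hc.comp (D.continuous_tensorFamily_contract F.cond φ)).congr fun t =>
        congrArg (F'.fam.pt _) (Eq.symm ?_)
      exact tmul_equiv_of_tmul
        (f := contract φ ∘ₗ (LinearEquiv.lTensor V (e t.1)).toLinearMap)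
        (g := (e t.1).toLinearMap ∘ₗ contract φ) (fun a b => by simp) t.2

/-- The map `[E] ↦ [Hom_A(V, E)]` on isomorphism classes. -/
def homVec : Vec.{u, v} (rhoKind ρ) X → Vec.{u, v} (twistedKind D.α) X :=
  Quotient.map D.homBundle fun E E' ⟨e, h, hc, _⟩ => by
    -- A `G`-equivariant isomorphism is in particular `A`-linear on each fibre, so composition with
    -- it preserves intertwining maps.
    have h' : ∀ (x : X) (a : A) (b : E.fam.fiber x),
        e x (fibRep (A := A) E.fam x a b) = fibRep (A := A) E'.fam x a (e x b) := fun x a b =>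
      h (a : G) x x (mk_coe_smul a x) b
    refine iso_of_continuous (D.homBundle E).isVB (D.homBundle E').isVB
      (fun x => intertwiningCongr (toRep ρ) (e x) (h' x)) (fun γ x y hxy f => ?_) ?_
    · refine Representation.IntertwiningMap.ext (LinearMap.ext fun a => ?_)
      refine ((e y).map_smul (γ.z : ℂ) _).trans (congrArg ((γ.z : ℂ) • ·) ?_)
      exact h (D.σ γ.q) x y (D.mk_σ_smul hxy) _
    · refine D.continuous_homFamily E'.fam (D.continuous_homFamily_proj E.fam) fun a => ?_
      exact hc.comp (D.continuous_homFamily_eval E.fam a)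

/-- Distributivity of `V ⊗ -` over Whitney sums. This and the next two compatibilities are proved
for `V ⊗ -` and inherited by its inverse `Hom_A(V, -)`. -/
theorem tensorVec_add (a b : Vec.{u, v} (twistedKind D.α) X) :
    D.tensorVec (a + b) = D.tensorVec a + D.tensorVec b := by
  induction a, b using Quotient.inductionOn₂ with
  | _ E F =>
    refine Bundle.cls_eq (E := D.tensorBundle (E.sum F))
      (F := (D.tensorBundle E).sum (D.tensorBundle F))
      (fun x => TensorProduct.prodRight ℂ ℂ V (E.fam.fiber x) (F.fam.fiber x))
      (fun g x y hxy a => ?_) ?_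
    · exact tmul_equiv_of_tmul
        (f := (TensorProduct.prodRight ℂ ℂ V (E.fam.fiber y) (F.fam.fiber y)).toLinearMap ∘ₗ
          TensorProduct.map (D.projRep g).toLinearEquiv.toLinearMap
            ((E.fam.act ⟨QuotientGroup.mk g, 1⟩ hxy).prodMap
              (F.fam.act ⟨QuotientGroup.mk g, 1⟩ hxy)))
        (g := ((TensorProduct.map (D.projRep g).toLinearEquiv.toLinearMap
            (E.fam.act ⟨QuotientGroup.mk g, 1⟩ hxy)).prodMap
          (TensorProduct.map (D.projRep g).toLinearEquiv.toLinearMap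
            (F.fam.act ⟨QuotientGroup.mk g, 1⟩ hxy))) ∘ₗ
          (TensorProduct.prodRight ℂ ℂ V (E.fam.fiber x) (F.fam.fiber x)).toLinearMap)
        (fun a b => by simp) a
    · refine (isInducing_sum _ _).continuous_iff.2 (Continuous.prodMk ?_ ?_)
      · refine D.continuous_tensorFamily E.cond (D.continuous_tensorFamily_proj (E.sum F).cond) fun φ => ?_
        refine ((continuous_sum_fst E.fam F.fam).comp
          (D.continuous_tensorFamily_contract (E.sum F).cond φ)).congr fun t =>
          congrArg (E.fam.pt _) (Eq.symm ?_)
        exact tmul_equiv_of_tmul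
          (f := contract φ ∘ₗ LinearMap.fst ℂ _ _ ∘ₗ
            (TensorProduct.prodRight ℂ ℂ V (E.fam.fiber t.1) (F.fam.fiber t.1)).toLinearMap)
          (g := LinearMap.fst ℂ _ _ ∘ₗ contract φ) (fun a b => by simp) t.2
      · refine D.continuous_tensorFamily F.cond (D.continuous_tensorFamily_proj (E.sum F).cond) fun φ => ?_
        refine ((continuous_sum_snd E.fam F.fam).comp
          (D.continuous_tensorFamily_contract (E.sum F).cond φ)).congr fun t =>
          congrArg (F.fam.pt _) (Eq.symm ?_)
        exact tmul_equiv_of_tmul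
          (f := contract φ ∘ₗ LinearMap.snd ℂ _ _ ∘ₗ
            (TensorProduct.prodRight ℂ ℂ V (E.fam.fiber t.1) (F.fam.fiber t.1)).toLinearMap)
          (g := LinearMap.snd ℂ _ _ ∘ₗ contract φ) (fun a b => by simp) t.2

/-- The interchange `V ⊗ (W ⊗ F) ≅ W ⊗ (V ⊗ F)` is equivariant because on both sides `g` acts on `W`
through its class in `Q`. -/
theorem tensorVec_smul (w : RepClass.{v} (G ⧸ A)) (a : Vec.{u, v} (twistedKind D.α) X) :
    D.tensorVec (w • a) = w • D.tensorVec a := by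
  induction w, a using Quotient.inductionOn₂ with
  | _ W F =>
    refine Bundle.cls_eq (E := D.tensorBundle (F.tensor W)) (F := (D.tensorBundle F).tensor W)
      (fun x => TensorProduct.leftComm ℂ V W.carrier (F.fam.fiber x))
      (fun g x y hxy a => ?_) ?_
    · refine DFunLike.congr_fun
        (f := (TensorProduct.leftComm ℂ V W.carrier (F.fam.fiber y)).toLinearMap ∘ₗ
          TensorProduct.map (D.projRep g).toLinearEquiv.toLinearMap
            (TensorProduct.map (W.rep (QuotientGroup.mk g))
              (F.fam.act ⟨QuotientGroup.mk g, 1⟩ hxy)))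
        (g := TensorProduct.map (W.rep (QuotientGroup.mk g))
            (TensorProduct.map (D.projRep g).toLinearEquiv.toLinearMap
              (F.fam.act ⟨QuotientGroup.mk g, 1⟩ hxy)) ∘ₗ
          (TensorProduct.leftComm ℂ V W.carrier (F.fam.fiber x)).toLinearMap) ?_ a
      refine TensorProduct.ext_threefold' fun a b c => ?_
      simp
    · refine (isInducing_tensor _ _).continuous_iff.2
        ((D.continuous_tensorFamily_proj (F.tensor W).cond).prodMk (continuous_pi fun φ => ?_))
      refine D.continuous_tensorFamily F.cond (D.continuous_tensorFamily_proj (F.tensor W).cond) fun ψ => ?_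
      refine ((continuous_tensor_contract W F.fam φ).comp
        (D.continuous_tensorFamily_contract (F.tensor W).cond ψ)).congr fun t =>
        congrArg (F.fam.pt _) (Eq.symm ?_)
      refine DFunLike.congr_fun (f := contract ψ ∘ₗ contract φ ∘ₗ
          (TensorProduct.leftComm ℂ V W.carrier (F.fam.fiber t.1)).toLinearMap)
        (g := contract φ ∘ₗ contract ψ) ?_ t.2
      refine TensorProduct.ext_threefold' fun a b c => ?_
      simp
      exact smul_comm _ _ _

/-- The two bundles have the same fibres and the same action; only the topologies of the total
spaces have to be compared. -/
theorem tensorVec_pull (f : EqMap (G ⧸ A) X Y) (a : Vec.{u, v} (twistedKind D.α) Y) :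
    D.tensorVec (Vec.pull f a) = Vec.pull f (D.tensorVec a) := by
  induction a using Quotient.ind with
  | _ F =>
    refine Bundle.cls_eq (E := D.tensorBundle (F.pullback f))
      (F := (D.tensorBundle F).pullback f) (fun x => LinearEquiv.refl _ _)
      (fun _ _ _ _ _ => rfl) ?_
    refine (isInducing_pullback _ _).continuous_iff.2
      ((D.continuous_tensorFamily_proj (F.pullback f).cond).prodMk ?_)
    refine D.continuous_tensorFamily F.cond
      (f.continuous.comp (D.continuous_tensorFamily_proj (F.pullback f).cond)) fun φ => ?_
    exact (continuous_snd.comp (isInducing_pullback f F.fam).continuous).comp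
      (D.continuous_tensorFamily_contract (F.pullback f).cond φ)

variable (X) in
/-- The isomorphism `[E] ↦ [Hom_A(V, E)]` of semimodules of isomorphism classes. -/
def vecEquiv : Vec.{u, v} (rhoKind ρ) X ≃ₗ[RepClass.{v} (G ⧸ A)]
    Vec.{u, v} (twistedKind D.α) X :=
  -- The linear structure is known for `tensorVec`, while `homVec` is the map wanted in the forward
  -- direction.
  LinearEquiv.symm
    { toFun := D.tensorVec
      map_add' := D.tensorVec_add
      map_smul' := D.tensorVec_smul
      invFun := D.homVec
      left_inv := fun a => by
        induction a using Quotient.ind with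
        | _ F => exact D.cls_homBundle_tensorBundle F
      right_inv := fun a => by
        induction a using Quotient.ind with
        | _ E => exact D.cls_tensorBundle_homBundle E }

theorem vecEquiv_pull (f : EqMap (G ⧸ A) X Y) (a : Vec.{u, v} (rhoKind ρ) Y) :
    D.vecEquiv X (Vec.pull f a) = Vec.pull f (D.vecEquiv Y a) := by
  rw [← LinearEquiv.eq_symm_apply]
  refine Eq.trans ?_ (D.tensorVec_pull f (D.vecEquiv Y a)).symm
  exact congrArg (Vec.pull f) ((D.vecEquiv Y).symm_apply_apply a).symm

variable (X) in
/-- The isomorphism `[E] ↦ [Hom_A(V, E)]` in `K`-theory. -/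
def K0Equiv : K0.{u, v} (rhoKind ρ) X ≃ₗ[RepRing.{v} (G ⧸ A)] K0.{u, v} (twistedKind D.α) X :=
  K0.congr (D.vecEquiv X)

theorem K0Equiv_of (E : Bundle.{u, v} (rhoKind ρ) X) :
    D.K0Equiv X (K0.of E) = K0.of (D.homBundle E) :=
  K0.congr_gOf (D.vecEquiv X) E.cls

theorem K0Equiv_pull (f : EqMap (G ⧸ A) X Y) (ξ : K0.{u, v} (rhoKind ρ) Y) :
    D.K0Equiv X (K0.pull f ξ) = K0.pull f (D.K0Equiv Y ξ) :=
  K0.congr_pull _ _ f (D.vecEquiv_pull f) ξ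

variable (X) in
/-- The isomorphism of the groups `Kⁿ` induced by `[E] ↦ [Hom_A(V, E)]`. -/
def KnEquiv (n : ℕ) :
    Kn.{u, v} (rhoKind ρ) n X ≃ₗ[RepRing.{v} (G ⧸ A)] Kn.{u, v} (twistedKind D.α) n X :=
  -- Naturality for the inclusion of the base point identifies the kernels of the two restriction
  -- maps.
  kerCongr (D.K0Equiv (SuspPlus n X)) (D.K0Equiv PUnit.{u + 1}) (D.K0Equiv_pull _)

theorem coe_KnEquiv (n : ℕ) (ξ : Kn.{u, v} (rhoKind ρ) n X) :
    (D.KnEquiv X n ξ : K0.{u, v} (twistedKind D.α) (SuspPlus n X))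
      = D.K0Equiv (SuspPlus n X) ξ := rfl

end Lifts

end EqK

end

/-! ### The main theorem. -/

theorem mainTheorem4 {G : Type w} [Group G] [Finite G] (A : Subgroup G) [A.Normal]
    {V : Type v} [NormedAddCommGroup V] [InnerProductSpace ℂ V] [FiniteDimensional ℂ V]
    (ρ : A →* (V ≃ₗᵢ[ℂ] V)) [Representation.IsIrreducible (EqK.toRep ρ)]
    (hinv : ∀ g : G,
      Nonempty (Representation.Equiv (EqK.toRep (EqK.conjRep g ρ)) (EqK.toRep ρ))) :
    Nonempty (EqK.Lifts ρ) ∧ ∀ D : EqK.Lifts ρ,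
      ∃ (Φ₀ : ∀ (X : Type u) [TopologicalSpace X] [CompactSpace X] [T2Space X]
          [MulAction G X] [ContinuousConstSMul G X] [EqK.ActsTrivially A X],
          EqK.K0 (EqK.rhoKind ρ) X ≃ₗ[EqK.RepRing.{v} (G ⧸ A)] EqK.K0 (EqK.twistedKind D.α) X)
        (Φ : ∀ (X : Type u) [TopologicalSpace X] [CompactSpace X] [T2Space X]
          [MulAction G X] [ContinuousConstSMul G X] [EqK.ActsTrivially A X] (n : ℕ),
          EqK.Kn (EqK.rhoKind ρ) n X ≃ₗ[EqK.RepRing.{v} (G ⧸ A)]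
            EqK.Kn (EqK.twistedKind D.α) n X),
        -- on `K⁰` the isomorphism is `[E] ↦ [Hom_A(V, E)]`
        (∀ (X : Type u) [TopologicalSpace X] [CompactSpace X] [T2Space X]
          [MulAction G X] [ContinuousConstSMul G X] [EqK.ActsTrivially A X]
          (E : EqK.Bundle (EqK.rhoKind ρ) X),
          ∃ F : EqK.Bundle (EqK.twistedKind D.α) X,
            F.fam = EqK.homFamily D E.fam ∧ Φ₀ X (EqK.K0.of E) = EqK.K0.of F) ∧
        -- naturality on `K⁰`
        (∀ (X Y : Type u) [TopologicalSpace X] [CompactSpace X] [T2Space X]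
          [MulAction G X] [ContinuousConstSMul G X] [EqK.ActsTrivially A X]
          [TopologicalSpace Y] [CompactSpace Y] [T2Space Y]
          [MulAction G Y] [ContinuousConstSMul G Y] [EqK.ActsTrivially A Y]
          (f : X → Y) (hf : Continuous f) (hG : ∀ (g : G) (x : X), f (g • x) = g • f x)
          (ξ : EqK.K0 (EqK.rhoKind ρ) Y),
          Φ₀ X (EqK.K0.pull (EqK.EqMap.ofG A f hf hG) ξ) =
            EqK.K0.pull (EqK.EqMap.ofG A f hf hG) (Φ₀ Y ξ)) ∧
        -- on `Kⁿ`, `[E] - [E'] ↦ [Hom_A(V, E)] - [Hom_A(V, E')]` for bundles over `Σⁿ X₊`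
        (∀ (X : Type u) [TopologicalSpace X] [CompactSpace X] [T2Space X]
          [MulAction G X] [ContinuousConstSMul G X] [EqK.ActsTrivially A X] (n : ℕ)
          (E E' : EqK.Bundle (EqK.rhoKind ρ) (EqK.SuspPlus n X))
          (h : EqK.K0.of E - EqK.K0.of E' ∈ EqK.Kn (EqK.rhoKind ρ) n X),
          ∃ F F' : EqK.Bundle (EqK.twistedKind D.α) (EqK.SuspPlus n X),
            F.fam = EqK.homFamily D E.fam ∧ F'.fam = EqK.homFamily D E'.fam ∧
            (Φ X n ⟨EqK.K0.of E - EqK.K0.of E', h⟩ :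
              EqK.K0 (EqK.twistedKind D.α) (EqK.SuspPlus n X)) =
              EqK.K0.of F - EqK.K0.of F') ∧
        -- naturality on `Kⁿ`
        (∀ (X Y : Type u) [TopologicalSpace X] [CompactSpace X] [T2Space X]
          [MulAction G X] [ContinuousConstSMul G X] [EqK.ActsTrivially A X]
          [TopologicalSpace Y] [CompactSpace Y] [T2Space Y]
          [MulAction G Y] [ContinuousConstSMul G Y] [EqK.ActsTrivially A Y]
          (f : X → Y) (hf : Continuous f) (hG : ∀ (g : G) (x : X), f (g • x) = g • f x)
          (n : ℕ) (ξ : EqK.Kn (EqK.rhoKind ρ) n Y),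
          Φ X n (EqK.Kn.pull (EqK.rhoKind ρ) n (EqK.EqMap.ofG A f hf hG) ξ) =
            EqK.Kn.pull (EqK.twistedKind D.α) n (EqK.EqMap.ofG A f hf hG) (Φ Y n ξ)) := by
  refine ⟨EqK.nonempty_lifts hinv, fun D => ⟨fun X _ _ _ _ _ _ => D.K0Equiv X, fun X _ _ _ _ _ _ n => D.KnEquiv X n,
    fun X _ _ _ _ _ _ E => ⟨D.homBundle E, rfl, D.K0Equiv_of E⟩,
    fun X Y _ _ _ _ _ _ _ _ _ _ _ _ f hf hG ξ => D.K0Equiv_pull _ ξ,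
    fun X _ _ _ _ _ _ n E E' h => ⟨D.homBundle E, D.homBundle E', rfl, rfl, ?_⟩,
    fun X Y _ _ _ _ _ _ _ _ _ _ _ _ f hf hG n ξ => Subtype.ext ?_⟩⟩
  · rw [D.coe_KnEquiv, map_sub, D.K0Equiv_of, D.K0Equiv_of]
  -- Naturality of `Kⁿ` is naturality of `K⁰` for the suspended map, since both `Kⁿ` maps are
  -- restrictions of `K⁰` maps.
  · exact D.K0Equiv_pull ((EqK.EqMap.ofG A f hf hG).susp n) ξ
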